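/- **Setting.** Work at a point of a four-dimensional Lorentzian manifold with metric $g$ of signature $(-,+,+,+)$ and volume form $\eta$. Let $W_{\alpha\beta\gamma\delta}$ be a Weyl-tensor candidate, i.e. $W_{\alpha\beta\gamma\delta}=W_{[\alpha\beta][\gamma\delta]}=W_{\gamma\delta\alpha\beta}$, $W_{\alpha[\beta\gamma\delta]}=0$, $W_{\alpha\mu\gamma}{}^{\mu}=0$. Put ${}^*W_{\alpha\beta\gamma\delta}=\tfrac12\eta_{\alpha\beta}{}^{\rho\sigma}W_{\rho\sigma\gamma\delta}$ and $$\mathcal B_{\alpha\beta\gamma\delta}=W_{\alpha\mu\gamma}{}^{\nu}W_{\delta\nu\beta}{}^{\mu}+{}^*W_{\alpha\mu\gamma}{}^{\nu}\,{}^*W_{\delta\nu\beta}{}^{\mu},\qquad \mathcal P^{\alpha}(u)=-u^\rho u^\sigma u^\mu\,\mathcal B^{\alpha}{}_{\rho\sigma\mu}.$$ Let $u$ be a unit timelike future vector and $n$ a unit spacelike vector with $n\cdot u=0$. All null vectors below are future oriented. A null tetrad $(k,\ell,m)$ has $k\cdot\ell=-1$ and $m\cdot\bar m=1$ as its only non-zero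 scalar products (those of $k,\ell,m,\bar m$); its Weyl scalars are $$\phi_0=W(k,m,k,m),\quad \phi_1=W(k,\ell,k,m),\quad \phi_2=W(k,m,\bar m,\ell),\quad \phi_3=W(k,\ell,\bar m,\ell),\quad \phi_4=W(\bar m,\ell,\bar m,\ell).$$ A null vector $k$ spans a principal null direction (PND) of multiplicity $q\in\{1,2,3,4\}$ if in the null tetrads with first vector $k$ one has $\phi_i=0$ for $i<q$ and $\phi_q\neq0$. The Petrov types are: I, four different simple PNDs; II, one double and two different simple ones; D, two different double ones; III, one triple and one simple; N, one quadruple. **Components and null rotations.** In every such tetrad $$u=a\,k+b\,\ell+d\,m+\bar d\,\bar m,\qquad ab-d\bar d=\tfrac12,\qquad a>0,\ b>0 .$$ For $c\in\mathbb C$ the null rotation keeping $\ell$ is $k\mapsto k+cm+\bar c\bar m+c\bar c\,\ell$, $m\mapsto m+\bar c\,\ell$, and the one keeping $k$ is $\ell\mapsto\ell+cm+\bar c\bar m+c\bar c\,k$, $m\mapsto m+\bar c\,k$. They produce again such tetrads, and for each null direction other than that of $\ell$ (resp. $k$) there is exactly one $c$ that rotates $k$ (resp. $\ell$) into it. A decoration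 on $a,b,d$ denotes the components of $u$ in the tetrad obtained with the equally decorated parameter. **Type I.** Let $k_1,k_2,k_3,k_4$ span the four PNDs, with $k_1\cdot k_2=k_3\cdot k_4=-1$, and let $(k_1,k_2,m)$ and $(k_3,k_4,\underline m)$ be null tetrads; quantities of the second one are underlined. In the first tetrad let $\tilde c$ (resp. $\breve c$) be the parameter that rotates $k_1$ into a vector $\tilde k_3$ parallel to $k_3$ (resp. $\breve k_4$ parallel to $k_4$) keeping $k_2$, and $c'$ (resp. $\hat c$) the one that rotates $k_2$ into the direction of $k_3$ (resp. $k_4$) keeping $k_1$. In the second tetrad let $\tilde f$ (resp. $\breve f$) rotate $k_3$ into the direction of $k_1$ (resp. $k_2$) keeping $k_4$, and $f'$ (resp. $\hat f$) rotate $k_4$ into the direction of $k_1$ (resp. $k_2$) keeping $k_3$. Put $B_1=n\cdot k_1$, $B_2=n\cdot k_2$, $\tilde B_3=n\cdot\tilde k_3$, $\breve B_4=n\cdot\breve k_4$, and $\alpha_1=-k_1\cdot k_4>0$. Then $$\begin{aligned} n_\mu\mathcal P^\mu(u)={}&\frac{4\,\underline\phi_3\bar{\underline\phi}_3}{\alpha_1}\Big\{B_1\Big[\underline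 a\,\breve f\bar{\breve f}\big(\tfrac13\hat{\underline a}\hat{\underline b}+\hat{\underline d}\bar{\hat{\underline d}}\big)+\underline b\big(\tfrac13\breve{\underline a}\breve{\underline b}+\breve{\underline d}\bar{\breve{\underline d}}\big)+\breve{\underline b}\big(\tfrac13\underline a\,\underline b+\underline d\bar{\underline d}\big)\Big]\\ &\qquad+B_2\,\breve c\bar{\breve c}\Big[\underline a\,\tilde f\bar{\tilde f}\big(\tfrac13\underline a'\underline b'+\underline d'\bar{\underline d}'\big)+\underline b\big(\tfrac13\tilde{\underline a}\tilde{\underline b}+\tilde{\underline d}\bar{\tilde{\underline d}}\big)+\tilde{\underline b}\big(\tfrac13\underline a\,\underline b+\underline d\bar{\underline d}\big)\Big]\Big\}\\ &+4\,\phi_3\bar\phi_3\Big\{\tilde B_3\Big[a\,\breve c\bar{\breve c}\big(\tfrac13\hat a\hat b+\hat d\bar{\hat d}\big)+b\big(\tfrac13\breve a\breve b+\breve d\bar{\breve d}\big)+\breve b\big(\tfrac13ab+d\bar d\big)\Big]\\ &\qquad+\breve B_4\Big[a\,\tilde c\bar{\tilde c}\big(\tfrac13a'b'+d'\bar d'\big)+b\big(\tfrac13\tilde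 a\tilde b+\tilde d\bar{\tilde d}\big)+\tilde b\big(\tfrac13ab+d\bar d\big)\Big]\Big\}, \end{aligned}$$ and the four square brackets are positive. (The factor $1/\alpha_1$ is $1$ if the scale of $k_3,k_4$ is fixed by $k_1\cdot k_4=-1$.) **Special types.** In a null tetrad $(k_1,k_2,m)$, with $B_1=n\cdot k_1$ and $B_2=n\cdot k_2$: * Type II, with $k_1$ the double PND, $k_2$ and $k_4$ the simple ones, and $\breve c,\hat c,\breve k_4,\breve B_4$ as above: $$\begin{aligned}n_\mu\mathcal P^\mu(u)=18\,\phi_2\bar\phi_2\Big\{&B_1\Big[a\big(\tfrac13\hat a\hat b+\hat d\bar{\hat d}\big)+b\,\hat c\bar{\hat c}\big(\tfrac13\breve a\breve b+\breve d\bar{\breve d}\big)+\hat a\big(\tfrac13ab+d\bar d\big)\Big]\\&+B_2\,b\big(\hat a\hat b+\hat d\bar{\hat d}\big)+\breve B_4\,\hat c\bar{\hat c}\,b\big(ab+d\bar d\big)\Big\}.\end{aligned}$$ * Type D, with $k_1,k_2$ the double PNDs: $n_\mu\mathcal P^\mu(u)=36\,\phi_2\bar\phi_2\,(aB_1+bB_2)(ab+d\bar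 d)$. * Type III, with $k_1$ the triple and $k_2$ the simple PND: $n_\mu\mathcal P^\mu(u)=8\,\phi_3\bar\phi_3\big[3b(ab+d\bar d)B_1+2b^3B_2\big]$. * Type N, with $k_1$ the quadruple PND ($k_2$ any null vector with $k_1\cdot k_2=-1$): $n_\mu\mathcal P^\mu(u)=4\,\phi_4\bar\phi_4\,b^3B_1$. -/

import Mathlib

open scoped ComplexConjugate

noncomputable section

namespace Superenergy

/-! Tensors at a point of a four-dimensional Lorentzian manifold, through their components in an
arbitrary basis of the tangent space; `g` is the matrix of the metric, of signature `(-,+,+,+)`.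
The inverse matrix `g⁻¹` raises indices. -/

/-- Components of a (real) vector. -/
abbrev Vec := Fin 4 → ℝ

/-- Components of a complex vector. -/
abbrev CVec := Fin 4 → ℂ

/-- Components of a covariant tensor of rank four. -/
abbrev Tensor4 := Fin 4 → Fin 4 → Fin 4 → Fin 4 → ℝ

/-- `g` is the Gram matrix of a bilinear form that has an orthonormal basis (the columns of `P`)
of signature `(-,+,+,+)`. -/
def IsLorentzian (g : Matrix (Fin 4) (Fin 4) ℝ) : Prop :=
  ∃ P : Matrix (Fin 4) (Fin 4) ℝ, P.transpose * g * P = Matrix.diagonal ![-1, 1, 1, 1]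

/-- Scalar product of two real vectors. -/
def dot (g : Matrix (Fin 4) (Fin 4) ℝ) (x y : Vec) : ℝ :=
  ∑ i, ∑ j, g i j * x i * y j

/-- Complex-bilinear extension of the scalar product. -/
def cdot (g : Matrix (Fin 4) (Fin 4) ℝ) (x y : CVec) : ℂ :=
  ∑ i, ∑ j, (g i j : ℂ) * x i * y j

/-- A real vector seen as a complex one. -/
def toC (x : Vec) : CVec := fun i => (x i : ℂ)

/-- Complex conjugate vector. -/
def cconj (x : CVec) : CVec := fun i => conj (x i)

/-- Weyl-tensor candidate: a tensor with the symmetry and trace properties of the Weyl tensor. -/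
structure IsWeylCandidate (g : Matrix (Fin 4) (Fin 4) ℝ) (W : Tensor4) : Prop where
  antisymm_left : ∀ a b c d, W a b c d = -W b a c d
  antisymm_right : ∀ a b c d, W a b c d = -W a b d c
  pair_symm : ∀ a b c d, W a b c d = W c d a b
  cyclic : ∀ a b c d, W a b c d + W a c d b + W a d b c = 0
  trace_free : ∀ a c, ∑ b, ∑ d, g⁻¹ b d * W a b c d = 0

/-- The Levi-Civita symbol: the determinant with rows the standard basis vectors
of indices `a, b, c, d`. -/
def leviCivita (a b c d : Fin 4) : ℝ :=
  Matrix.det (Matrix.of fun i j : Fin 4 => if (![a, b, c, d] : Fin 4 → Fin 4) i = j then (1 : ℝ) else 0)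

/-- Components of the volume form, for the orientation in which the basis is positive. -/
def volumeForm (g : Matrix (Fin 4) (Fin 4) ℝ) : Tensor4 := fun a b c d =>
  Real.sqrt (-g.det) * leviCivita a b c d

/-- Hodge dual on the first pair of indices,
`*W_{abcd} = (1/2) η_{ab}^{rs} W_{rscd}`. -/
def hodgeDual (g : Matrix (Fin 4) (Fin 4) ℝ) (W : Tensor4) : Tensor4 := fun a b c d =>
  (1 / 2) * ∑ r, ∑ s, ∑ p, ∑ q, volumeForm g a b r s * g⁻¹ r p * g⁻¹ s q * W p q c d

/-- The mixed components `W_{abc}^d`. -/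
def raiseLast (g : Matrix (Fin 4) (Fin 4) ℝ) (W : Tensor4) : Tensor4 := fun a b c d =>
  ∑ e, W a b c e * g⁻¹ e d

/-- Bel-Robinson tensor
`W_{a μ c}^ν W_{d ν b}^μ + *W_{a μ c}^ν *W_{d ν b}^μ`. -/
def belRobinson (g : Matrix (Fin 4) (Fin 4) ℝ) (W : Tensor4) : Tensor4 := fun a b c d =>
  ∑ μ, ∑ ν, (raiseLast g W a μ c ν * raiseLast g W d ν b μ
    + raiseLast g (hodgeDual g W) a μ c ν * raiseLast g (hodgeDual g W) d ν b μ)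

/-- Supermomentum `P^a(u) = - u^r u^s u^t B^a_{rst}`. -/
def supermomentum (g : Matrix (Fin 4) (Fin 4) ℝ) (W : Tensor4) (u : Vec) : Vec := fun a =>
  -∑ b, ∑ r, ∑ s, ∑ t, g⁻¹ a b * belRobinson g W b r s t * u r * u s * u t

/-- A causal vector `k` has the time orientation of the timelike vector `u`. As `u` is future
oriented by convention, this says that `k` is future oriented. -/
def IsFuture (g : Matrix (Fin 4) (Fin 4) ℝ) (u k : Vec) : Prop := dot g k u < 0

/-- Two vectors span the same direction. -/
def SameDirection (x y : Vec) : Prop := ∃ r : ℝ, r ≠ 0 ∧ x = r • y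

/-- The data of a tetrad `(k, l, m, conj m)`. -/
structure Tetrad where
  k : Vec
  l : Vec
  m : CVec

/-- Null tetrad: the only nonzero scalar products are `k·l = -1` and `m·(conj m) = 1`. -/
structure IsNullTetrad (g : Matrix (Fin 4) (Fin 4) ℝ) (T : Tetrad) : Prop where
  kk : dot g T.k T.k = 0
  ll : dot g T.l T.l = 0
  kl : dot g T.k T.l = -1
  mm : cdot g T.m T.m = 0
  mmbar : cdot g T.m (cconj T.m) = 1
  km : cdot g (toC T.k) T.m = 0
  lm : cdot g (toC T.l) T.m = 0

/-- Null tetrad whose two real null vectors are future oriented. -/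
structure IsFutureTetrad (g : Matrix (Fin 4) (Fin 4) ℝ) (u : Vec) (T : Tetrad) : Prop where
  null : IsNullTetrad g T
  future_k : IsFuture g u T.k
  future_l : IsFuture g u T.l

/-- Null rotation that keeps `l`:
`k ↦ k + c m + conj c conj m + |c|² l` (a real vector), `m ↦ m + conj c l`. -/
def Tetrad.rotFirst (T : Tetrad) (c : ℂ) : Tetrad where
  k := fun i => T.k i + 2 * (c * T.m i).re + Complex.normSq c * T.l i
  l := T.l
  m := fun i => T.m i + conj c * (T.l i : ℂ)

/-- Null rotation that keeps `k`:
`l ↦ l + c m + conj c conj m + |c|² k` (a real vector), `m ↦ m + conj c k`. -/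
def Tetrad.rotSecond (T : Tetrad) (c : ℂ) : Tetrad where
  k := T.k
  l := fun i => T.l i + 2 * (c * T.m i).re + Complex.normSq c * T.k i
  m := fun i => T.m i + conj c * (T.k i : ℂ)

/-- `W` evaluated on four complex vectors. -/
def evalC (W : Tensor4) (x y z w : CVec) : ℂ :=
  ∑ a, ∑ b, ∑ c, ∑ d, (W a b c d : ℂ) * x a * y b * z c * w d

/-- The five complex Weyl scalars `φ₀, …, φ₄` in a null tetrad. -/
def weylScalar (W : Tensor4) (T : Tetrad) : Fin 5 → ℂ :=
  ![evalC W (toC T.k) T.m (toC T.k) T.m,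
    evalC W (toC T.k) (toC T.l) (toC T.k) T.m,
    evalC W (toC T.k) T.m (cconj T.m) (toC T.l),
    evalC W (toC T.k) (toC T.l) (cconj T.m) (toC T.l),
    evalC W (cconj T.m) (toC T.l) (cconj T.m) (toC T.l)]

/-- The null vector `k` spans a principal null direction of `W` of multiplicity exactly `q`
(`1 ≤ q ≤ 4`): in the null tetrads with first vector `k`, the Weyl scalars `φ_i` with `i < q`
vanish and `φ_q` does not. -/
def IsPND (g : Matrix (Fin 4) (Fin 4) ℝ) (W : Tensor4) (q : Fin 5) (k : Vec) : Prop :=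
  k ≠ 0 ∧ dot g k k = 0 ∧ 0 < q ∧
    ∀ T : Tetrad, IsNullTetrad g T → T.k = k →
      (∀ i < q, weylScalar W T i = 0) ∧ weylScalar W T q ≠ 0

/-- Petrov type I: four different simple principal null directions, spanned by the `kᵢ`. -/
def IsPetrovI (g : Matrix (Fin 4) (Fin 4) ℝ) (W : Tensor4) (k₁ k₂ k₃ k₄ : Vec) : Prop :=
  IsPND g W 1 k₁ ∧ IsPND g W 1 k₂ ∧ IsPND g W 1 k₃ ∧ IsPND g W 1 k₄ ∧
    [k₁, k₂, k₃, k₄].Pairwise fun x y => ¬SameDirection x y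

/-- Petrov type II: one double principal null direction `k₁` and two simple ones, `k₂, k₄`. -/
def IsPetrovII (g : Matrix (Fin 4) (Fin 4) ℝ) (W : Tensor4) (k₁ k₂ k₄ : Vec) : Prop :=
  IsPND g W 2 k₁ ∧ IsPND g W 1 k₂ ∧ IsPND g W 1 k₄ ∧
    [k₁, k₂, k₄].Pairwise fun x y => ¬SameDirection x y

/-- Petrov type D: two different double principal null directions. -/
def IsPetrovD (g : Matrix (Fin 4) (Fin 4) ℝ) (W : Tensor4) (k₁ k₂ : Vec) : Prop :=
  IsPND g W 2 k₁ ∧ IsPND g W 2 k₂ ∧ ¬SameDirection k₁ k₂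

/-- Petrov type III: a triple principal null direction `k₁` and a simple one, `k₂`. -/
def IsPetrovIII (g : Matrix (Fin 4) (Fin 4) ℝ) (W : Tensor4) (k₁ k₂ : Vec) : Prop :=
  IsPND g W 3 k₁ ∧ IsPND g W 1 k₂ ∧ ¬SameDirection k₁ k₂

/-- Petrov type N: one quadruple principal null direction. -/
def IsPetrovN (g : Matrix (Fin 4) (Fin 4) ℝ) (W : Tensor4) (k₁ : Vec) : Prop :=
  IsPND g W 4 k₁

/-- The component `a` in `u = a k + b l + d m + conj d conj m`. -/
def compA (g : Matrix (Fin 4) (Fin 4) ℝ) (u : Vec) (T : Tetrad) : ℝ := -dot g u T.l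

/-- The component `b` in `u = a k + b l + d m + conj d conj m`. -/
def compB (g : Matrix (Fin 4) (Fin 4) ℝ) (u : Vec) (T : Tetrad) : ℝ := -dot g u T.k

/-- The component `d` in `u = a k + b l + d m + conj d conj m`. -/
def compD (g : Matrix (Fin 4) (Fin 4) ℝ) (u : Vec) (T : Tetrad) : ℂ := cdot g (toC u) (cconj T.m)

/-- `a b / 3 + d conj d`. -/
def third (g : Matrix (Fin 4) (Fin 4) ℝ) (u : Vec) (T : Tetrad) : ℝ :=
  1 / 3 * (compA g u T * compB g u T) + Complex.normSq (compD g u T)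

/-- `a b + d conj d`. -/
def whole (g : Matrix (Fin 4) (Fin 4) ℝ) (u : Vec) (T : Tetrad) : ℝ :=
  compA g u T * compB g u T + Complex.normSq (compD g u T)

/-- With `u = (a, b, d)` in the tetrad `T`, `(a₁, b₁, d₁)` in its rotation `T.rotFirst c` and
`(a₂, b₂, d₂)` in its rotation `T.rotSecond e`, the expression
`a |c|² (a₂ b₂ / 3 + |d₂|²) + b (a₁ b₁ / 3 + |d₁|²) + b₁ (a b / 3 + |d|²)`. -/
def bracket (g : Matrix (Fin 4) (Fin 4) ℝ) (u : Vec) (T : Tetrad) (c e : ℂ) : ℝ :=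
  compA g u T * Complex.normSq c * third g u (T.rotSecond e)
    + compB g u T * third g u (T.rotFirst c)
    + compB g u (T.rotFirst c) * third g u T

/-- The null rotations of `T` with parameters `c` and `e` bring, respectively, the first and the
second null vector of `T` into the direction of `x`. -/
def RotateTo (T : Tetrad) (x : Vec) (c e : ℂ) : Prop :=
  SameDirection (T.rotFirst c).k x ∧ SameDirection (T.rotSecond e).l x

end Superenergy

end

open Superenergy

namespace Superenergy

/-! The Bel-Robinson tensor is `4 Ψ_{ABCD} Ψ̄_{A'B'C'D'}`, and the Weyl spinor `Ψ` is, up to a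
factor, the symmetrised product of its four principal spinors. Hence the tensor is a multiple of the
trace-free part of the symmetrised product of the four principal null vectors, each repeated
according to its multiplicity. Evaluated on `(n, u, u, u)` this is a polynomial in scalar products,
namely `fluxForm` up to the factor `-64`. Because `n` is orthogonal to `u`, what survives is a sum
over the principal null vectors of `n·kᵢ` times a cubic in `u`, `tripleForm`, built from the other
three.

Spinors enter only through components. In a null tetrad, `frameComp_eq` splits `W` into a self-dual
part with coefficients `φᵢ` and an anti-self-dual part with the conjugate coefficients. The dual
multiplies the two parts by `±v` with `v² = -1` (`tetradVolume_sq`), so in the sum of the two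
quadratic terms only the mixed products remain. `trace_slotMatrix` identifies these with the spinor
product, and `dot_supermomentum_eq` gives the flux in terms of the `φᵢ`.

Principal directions enter through the quartic of `weylScalar_rotFirst_zero`: the null rotation that
keeps `l` carries `k` to a principal direction only if `conj c` is a root. When `k` and `l` are
principal, `φ₀ = φ₄ = 0`, and for types I, II and III the other two roots express `φ₁` and `φ₂`
through `φ₃` by Vieta; `dot_supermomentum_of_roots` then turns the flux into `fluxForm`. Types D and
N leave a single scalar and are expanded directly.

The brackets of the statement are these cubics in disguise (`bracket_eq`): `u·u = -1` gives `ab -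
|d|² = 1/2`, so each of the three summands carries one third of the leading term. For type I, two of
the four cubics are read in the second tetrad, and `petrovI_scalar_eq` relates the two values of
`φ₃`. -/

/-- Complex components of the metric. -/
def gC (g : Matrix (Fin 4) (Fin 4) ℝ) : Matrix (Fin 4) (Fin 4) ℂ := g.map (fun x => (x : ℂ))

/-- The vectors `k, l, m, conj m` of a tetrad, as the rows of a matrix. -/
def Tetrad.frame (T : Tetrad) : Matrix (Fin 4) (Fin 4) ℂ :=
  Matrix.of ![toC T.k, toC T.l, T.m, cconj T.m]

/-- Gram matrix of a null tetrad. -/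
def nullGram : Matrix (Fin 4) (Fin 4) ℂ := !![0, -1, 0, 0; -1, 0, 0, 0; 0, 0, 0, 1; 0, 0, 1, 0]

lemma nullGram_mul_self : nullGram * nullGram = 1 := by
  ext i j; fin_cases i <;> fin_cases j <;> simp [nullGram, Matrix.mul_apply, Fin.sum_univ_four]

lemma nullGram_det : nullGram.det = 1 := by
  simp [nullGram, Matrix.det_succ_row_zero, Fin.sum_univ_succ, Fin.succAbove, Matrix.of_apply]

lemma IsLorentzian.det_neg {g : Matrix (Fin 4) (Fin 4) ℝ} (hg : IsLorentzian g) : g.det < 0 := by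
  obtain ⟨P, hP⟩ := hg
  have h := congrArg Matrix.det hP
  rw [Matrix.det_mul, Matrix.det_mul, Matrix.det_transpose, Matrix.det_diagonal] at h
  simp [Fin.prod_univ_four] at h
  by_contra h0
  have := mul_nonneg (not_lt.mp h0) (mul_self_nonneg P.det)
  nlinarith

/-- Symmetry is not part of the definition; it follows because `g` is congruent to a diagonal matrix
through a matrix whose determinant cannot vanish. -/
lemma IsLorentzian.symm {g : Matrix (Fin 4) (Fin 4) ℝ} (hg : IsLorentzian g) :
    g.transpose = g := by
  obtain ⟨P, hP⟩ := hg
  have h := congrArg Matrix.det hP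
  rw [Matrix.det_mul, Matrix.det_mul, Matrix.det_transpose, Matrix.det_diagonal] at h
  simp [Fin.prod_univ_four] at h
  have hu : IsUnit P.det := by
    rw [isUnit_iff_ne_zero]; rintro h0; simp [h0] at h
  have h1 : P.transpose * g.transpose * P = P.transpose * g * P := by
    rw [hP]
    have := congrArg Matrix.transpose hP
    rw [Matrix.transpose_mul, Matrix.transpose_mul, Matrix.transpose_transpose,
      Matrix.diagonal_transpose, ← Matrix.mul_assoc] at this
    exact this
  have hP' : IsUnit P := (Matrix.isUnit_iff_isUnit_det P).mpr hu
  have hPt : IsUnit P.transpose := by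
    rw [Matrix.isUnit_iff_isUnit_det, Matrix.det_transpose]; exact hu
  exact hPt.mul_left_cancel (hP'.mul_right_cancel h1)

/-! ### Bilinearity of the scalar products -/

section Products

variable {g : Matrix (Fin 4) (Fin 4) ℝ}

lemma dot_comm (hg : IsLorentzian g) (x y : Vec) : dot g x y = dot g y x := by
  have h : ∀ i j, g i j = g j i := fun i j => congrFun (congrFun hg.symm j) i
  unfold dot
  rw [Finset.sum_comm]
  refine Finset.sum_congr rfl fun i _ => Finset.sum_congr rfl fun j _ => ?_
  rw [h j i]; ring

lemma cdot_comm (hg : IsLorentzian g) (x y : CVec) : cdot g x y = cdot g y x := by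
  have h : ∀ i j, g i j = g j i := fun i j => congrFun (congrFun hg.symm j) i
  unfold cdot
  rw [Finset.sum_comm]
  refine Finset.sum_congr rfl fun i _ => Finset.sum_congr rfl fun j _ => ?_
  rw [h j i]; ring

lemma cdot_toC (x y : Vec) : cdot g (toC x) (toC y) = dot g x y := by
  simp [cdot, toC, dot]

lemma conj_cdot (x y : CVec) : conj (cdot g x y) = cdot g (cconj x) (cconj y) := by
  simp [cdot, cconj, map_sum]

@[simp] lemma cconj_toC (x : Vec) : cconj (toC x) = toC x := by
  funext i; simp [cconj, toC]

@[simp] lemma cconj_cconj (x : CVec) : cconj (cconj x) = x := by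
  funext i; simp [cconj]

lemma cdot_add_left (x y z : CVec) : cdot g (x + y) z = cdot g x z + cdot g y z := by
  simp [cdot, mul_add, add_mul, Finset.sum_add_distrib]

lemma cdot_smul_left (r : ℂ) (x z : CVec) : cdot g (r • x) z = r * cdot g x z := by
  simp only [cdot, Finset.mul_sum, Pi.smul_apply, smul_eq_mul]
  refine Finset.sum_congr rfl fun i _ => Finset.sum_congr rfl fun j _ => by ring

lemma cdot_add_right (x y z : CVec) : cdot g x (y + z) = cdot g x y + cdot g x z := by
  simp [cdot, mul_add, Finset.sum_add_distrib]

lemma cdot_smul_right (r : ℂ) (x z : CVec) : cdot g x (r • z) = r * cdot g x z := by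
  simp only [cdot, Finset.mul_sum, Pi.smul_apply, smul_eq_mul]
  refine Finset.sum_congr rfl fun i _ => Finset.sum_congr rfl fun j _ => by ring

lemma dot_smul_left (r : ℝ) (x z : Vec) : dot g (r • x) z = r * dot g x z := by
  simp only [dot, Finset.mul_sum, Pi.smul_apply, smul_eq_mul]
  refine Finset.sum_congr rfl fun i _ => Finset.sum_congr rfl fun j _ => by ring

lemma dot_smul_right (r : ℝ) (x z : Vec) : dot g x (r • z) = r * dot g x z := by
  simp only [dot, Finset.mul_sum, Pi.smul_apply, smul_eq_mul]
  refine Finset.sum_congr rfl fun i _ => Finset.sum_congr rfl fun j _ => by ring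

lemma mul_gC_mul_transpose_apply (A B : Matrix (Fin 4) (Fin 4) ℂ) (i j : Fin 4) :
    (A * gC g * B.transpose) i j = cdot g (A i) (B j) := by
  simp only [Matrix.mul_apply, gC, Matrix.map_apply, Matrix.transpose_apply, cdot, Finset.sum_mul]
  rw [Finset.sum_comm]
  refine Finset.sum_congr rfl fun a _ => Finset.sum_congr rfl fun b _ => by ring

end Products

/-! ### Metric and vectors in a null tetrad -/

section Frame

variable {g : Matrix (Fin 4) (Fin 4) ℝ} {T : Tetrad}

@[simp] lemma Tetrad.frame_zero (T : Tetrad) : T.frame 0 = toC T.k := rfl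
@[simp] lemma Tetrad.frame_one (T : Tetrad) : T.frame 1 = toC T.l := rfl
@[simp] lemma Tetrad.frame_two (T : Tetrad) : T.frame 2 = T.m := rfl
@[simp] lemma Tetrad.frame_three (T : Tetrad) : T.frame 3 = cconj T.m := rfl

lemma IsNullTetrad.cdot_frame (hg : IsLorentzian g) (hT : IsNullTetrad g T) (i j : Fin 4) :
    cdot g (T.frame i) (T.frame j) = nullGram i j := by
  have e1 : cdot g (toC T.k) (cconj T.m) = 0 := by
    rw [← cconj_toC T.k, ← conj_cdot, hT.km, map_zero]
  have e2 : cdot g (toC T.l) (cconj T.m) = 0 := by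
    rw [← cconj_toC T.l, ← conj_cdot, hT.lm, map_zero]
  have e3 : cdot g (cconj T.m) (cconj T.m) = 0 := by
    rw [← conj_cdot, hT.mm, map_zero]
  have hkl := hT.kl
  have hlk : dot g T.l T.k = -1 := by rw [dot_comm hg]; exact hkl
  fin_cases i <;> fin_cases j <;>
    simp [nullGram, cdot_toC, hT.kk, hT.ll, hkl, hlk, hT.mm, hT.mmbar, hT.km, hT.lm, e1, e2, e3,
      cdot_comm hg T.m (toC _), cdot_comm hg (cconj T.m) (toC _), cdot_comm hg (cconj T.m) T.m]

lemma IsNullTetrad.frame_gram (hg : IsLorentzian g) (hT : IsNullTetrad g T) :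
    T.frame * gC g * T.frame.transpose = nullGram := by
  ext i j
  rw [mul_gC_mul_transpose_apply, hT.cdot_frame hg]

lemma gC_inv (hg : IsLorentzian g) : gC g⁻¹ = (gC g)⁻¹ := by
  symm
  apply Matrix.inv_eq_right_inv
  have h : IsUnit g.det := hg.det_neg.ne.isUnit
  have := congrArg (fun M : Matrix (Fin 4) (Fin 4) ℝ => M.map (Complex.ofRealHom))
    (Matrix.mul_nonsing_inv g h)
  rw [Matrix.map_mul, Matrix.map_one _ (map_zero _) (map_one _)] at this
  exact this

/-- With `F` the frame and `N` its Gram matrix, `F g Fᵀ = N` and `N² = 1` exhibit `N F` as an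
inverse of `g Fᵀ`. This is the completeness relation that carries raised indices into the tetrad. -/
lemma IsNullTetrad.gC_inv_eq (hg : IsLorentzian g) (hT : IsNullTetrad g T) :
    gC g⁻¹ = T.frame.transpose * nullGram * T.frame := by
  rw [gC_inv hg]
  apply Matrix.inv_eq_right_inv
  have h1 : nullGram * T.frame * (gC g * T.frame.transpose) = 1 := by
    rw [Matrix.mul_assoc, ← Matrix.mul_assoc T.frame, hT.frame_gram hg, nullGram_mul_self]
  have h2 := mul_eq_one_comm.mp h1
  simpa only [Matrix.mul_assoc] using h2

/-- Components of a vector in a null tetrad. -/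
def Tetrad.coord (g : Matrix (Fin 4) (Fin 4) ℝ) (T : Tetrad) (x : CVec) : Fin 4 → ℂ :=
  ![-cdot g x (toC T.l), -cdot g x (toC T.k), cdot g x (cconj T.m), cdot g x T.m]

lemma IsNullTetrad.eq_coord_vecMul (hg : IsLorentzian g) (hT : IsNullTetrad g T) (x : CVec) :
    x = Matrix.vecMul (T.coord g x) T.frame := by
  have h1 : T.frame.transpose * nullGram * T.frame * gC g = 1 := by
    rw [← hT.gC_inv_eq hg, gC_inv hg]
    apply Matrix.nonsing_inv_mul
    have h := congrArg Matrix.det (hT.frame_gram hg)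
    rw [Matrix.det_mul, Matrix.det_mul, nullGram_det] at h
    rw [isUnit_iff_ne_zero]
    rintro h0
    simp [h0] at h
  have h2 : gC g * (T.frame.transpose * nullGram * T.frame) = 1 := mul_eq_one_comm.mp h1
  have h3 : T.coord g x
      = Matrix.vecMul x (gC g * (T.frame.transpose * nullGram)) := by
    have h4 : ∀ j, Matrix.vecMul x (gC g * T.frame.transpose) j = cdot g x (T.frame j) := by
      intro j
      rw [← Matrix.vecMul_vecMul]
      simp only [Matrix.vecMul, dotProduct, gC, Matrix.map_apply, Matrix.transpose_apply, cdot,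
        Finset.sum_mul]
      rw [Finset.sum_comm]
      refine Finset.sum_congr rfl fun a _ => Finset.sum_congr rfl fun b _ => by ring
    rw [← Matrix.mul_assoc, ← Matrix.vecMul_vecMul]
    funext i
    rw [Matrix.vecMul, dotProduct, Fin.sum_univ_four, h4, h4, h4, h4]
    fin_cases i <;> simp [Tetrad.coord, nullGram]
  rw [h3, Matrix.vecMul_vecMul, Matrix.mul_assoc, h2, Matrix.vecMul_one]

lemma cdot_vecMul_frame (hg : IsLorentzian g) (hT : IsNullTetrad g T) (X Y : Fin 4 → ℂ) :
    cdot g (Matrix.vecMul X T.frame) (Matrix.vecMul Y T.frame)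
      = -(X 0 * Y 1) - X 1 * Y 0 + X 2 * Y 3 + X 3 * Y 2 := by
  have h : ∀ Z : Fin 4 → ℂ, Matrix.vecMul Z T.frame
      = Z 0 • T.frame 0 + (Z 1 • T.frame 1 + (Z 2 • T.frame 2 + Z 3 • T.frame 3)) := by
    intro Z; funext i
    simp [Matrix.vecMul, dotProduct, Fin.sum_univ_four]
    ring
  rw [h X, h Y]
  simp only [cdot_add_left, cdot_smul_left, cdot_add_right, cdot_smul_right,
    hT.cdot_frame hg]
  simp [nullGram]
  ring

end Frame
-- Multilinear evaluation of the curvature and the flux as a trace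
/-- The matrix `W(x, ·, y, ·)`. -/
def curv (W : Tensor4) (x y : CVec) : Matrix (Fin 4) (Fin 4) ℂ :=
  Matrix.of fun μ e => ∑ a, ∑ c, (W a μ c e : ℂ) * x a * y c

/-- Components of `W` in the complex basis given by a tetrad. -/
def frameComp (W : Tensor4) (T : Tetrad) (i j k l : Fin 4) : ℂ :=
  evalC W (T.frame i) (T.frame j) (T.frame k) (T.frame l)

lemma mul_curv_mul_transpose_apply (W : Tensor4) (x y : CVec) (A : Matrix (Fin 4) (Fin 4) ℂ)
    (i j : Fin 4) : (A * curv W x y * A.transpose) i j = evalC W x (A i) y (A j) := by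
  simp only [Matrix.mul_apply, curv, Matrix.of_apply, Matrix.transpose_apply, Finset.sum_mul,
    Finset.mul_sum, evalC]
  calc _ = ∑ d, ∑ a, ∑ b, ∑ c, A i b * ((W a b c d : ℂ) * x a * y c) * A j d :=
        Finset.sum_congr rfl fun d _ => Finset.sum_comm
    _ = ∑ a, ∑ d, ∑ b, ∑ c, A i b * ((W a b c d : ℂ) * x a * y c) * A j d := Finset.sum_comm
    _ = ∑ a, ∑ b, ∑ d, ∑ c, A i b * ((W a b c d : ℂ) * x a * y c) * A j d :=
        Finset.sum_congr rfl fun a _ => Finset.sum_comm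
    _ = ∑ a, ∑ b, ∑ c, ∑ d, A i b * ((W a b c d : ℂ) * x a * y c) * A j d :=
        Finset.sum_congr rfl fun a _ => Finset.sum_congr rfl fun b _ => Finset.sum_comm
    _ = _ := by
        refine Finset.sum_congr rfl fun a _ => Finset.sum_congr rfl fun b _ =>
          Finset.sum_congr rfl fun c _ => Finset.sum_congr rfl fun d _ => by ring

lemma evalC_vecMul_first (W : Tensor4) (A : Matrix (Fin 4) (Fin 4) ℂ) (X y z w : Fin 4 → ℂ) :
    evalC W (Matrix.vecMul X A) y z w = ∑ i, X i * evalC W (A i) y z w := by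
  have h : ∀ x, evalC W x y z w = ∑ a, x a * ∑ b, ∑ c, ∑ d, (W a b c d : ℂ) * y b * z c * w d := by
    intro x
    simp only [evalC, Finset.mul_sum]
    refine Finset.sum_congr rfl fun a _ => Finset.sum_congr rfl fun b _ =>
          Finset.sum_congr rfl fun c _ => Finset.sum_congr rfl fun d _ => by ring
  simp only [h]
  simp only [Matrix.vecMul, dotProduct, Finset.sum_mul]
  rw [Finset.sum_comm]
  refine Finset.sum_congr rfl fun i _ => ?_
  rw [Finset.mul_sum]
  refine Finset.sum_congr rfl fun a _ => by ring

lemma evalC_swap_left (W : Tensor4) (x y z w : CVec) :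
    evalC W x y z w = evalC (fun a b c d => W b a c d) y x z w := by
  unfold evalC
  rw [Finset.sum_comm]
  refine Finset.sum_congr rfl fun a _ => Finset.sum_congr rfl fun b _ =>
          Finset.sum_congr rfl fun c _ => Finset.sum_congr rfl fun d _ => by ring

lemma evalC_swap_right (W : Tensor4) (x y z w : CVec) :
    evalC W x y z w = evalC (fun a b c d => W a b d c) x y w z := by
  unfold evalC
  refine Finset.sum_congr rfl fun a _ => Finset.sum_congr rfl fun b _ => ?_
  rw [Finset.sum_comm]
  refine Finset.sum_congr rfl fun c _ => Finset.sum_congr rfl fun d _ => by ring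

lemma evalC_swap_middle (W : Tensor4) (x y z w : CVec) :
    evalC W x y z w = evalC (fun a b c d => W a c b d) x z y w := by
  unfold evalC
  refine Finset.sum_congr rfl fun a _ => ?_
  rw [Finset.sum_comm]
  refine Finset.sum_congr rfl fun b _ =>
          Finset.sum_congr rfl fun c _ => Finset.sum_congr rfl fun d _ => by ring

lemma evalC_vecMul_second (W : Tensor4) (A : Matrix (Fin 4) (Fin 4) ℂ) (x Y z w : Fin 4 → ℂ) :
    evalC W x (Matrix.vecMul Y A) z w = ∑ i, Y i * evalC W x (A i) z w := by
  rw [evalC_swap_left, evalC_vecMul_first]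
  exact Finset.sum_congr rfl fun i _ => by rw [evalC_swap_left W]

lemma evalC_vecMul_third (W : Tensor4) (A : Matrix (Fin 4) (Fin 4) ℂ) (x y Z w : Fin 4 → ℂ) :
    evalC W x y (Matrix.vecMul Z A) w = ∑ i, Z i * evalC W x y (A i) w := by
  rw [evalC_swap_middle, evalC_vecMul_second]
  exact Finset.sum_congr rfl fun i _ => by rw [evalC_swap_middle W]

lemma evalC_vecMul_fourth (W : Tensor4) (A : Matrix (Fin 4) (Fin 4) ℂ) (x y z V : Fin 4 → ℂ) :
    evalC W x y z (Matrix.vecMul V A) = ∑ i, V i * evalC W x y z (A i) := by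
  rw [evalC_swap_right, evalC_vecMul_third]
  exact Finset.sum_congr rfl fun i _ => by rw [evalC_swap_right W]

lemma conj_evalC (W : Tensor4) (x y z w : CVec) :
    conj (evalC W x y z w) = evalC W (cconj x) (cconj y) (cconj z) (cconj w) := by
  simp [evalC, cconj, map_sum]

lemma trace_frame_change (F N A B : Matrix (Fin 4) (Fin 4) ℂ) :
    (A * (F.transpose * N * F) * B * (F.transpose * N * F)).trace
      = ((F * A * F.transpose) * N * (F * B * F.transpose) * N).trace := by
  have h : A * (F.transpose * N * F) * B * (F.transpose * N * F)
      = (A * F.transpose * N * F * B * F.transpose * N) * F := by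
    simp only [Matrix.mul_assoc]
  rw [h, Matrix.trace_mul_comm]
  simp only [Matrix.mul_assoc]

lemma sum_mul_frame_change (F V M : Matrix (Fin 4) (Fin 4) ℂ) :
    ∑ r, ∑ s, V r s * (F.transpose * M * F) r s
      = ∑ i, ∑ j, (F * V * F.transpose) i j * M i j := by
  have h : ∀ A B : Matrix (Fin 4) (Fin 4) ℂ,
      ∑ r, ∑ s, A r s * B r s = (A * B.transpose).trace := by
    intro A B
    simp only [Matrix.trace, Matrix.diag_apply, Matrix.mul_apply, Matrix.transpose_apply]
  rw [h, h]
  simp only [Matrix.transpose_mul, Matrix.transpose_transpose]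
  have h2 : V * (F.transpose * (M.transpose * F)) = (V * F.transpose * M.transpose) * F := by
    simp only [Matrix.mul_assoc]
  rw [h2, Matrix.trace_mul_comm]
  simp only [Matrix.mul_assoc]

lemma sum_comm_five (f : Fin 4 → Fin 4 → Fin 4 → Fin 4 → Fin 4 → ℂ) :
    ∑ a, ∑ b, ∑ c, ∑ d, ∑ e, f a b c d e = ∑ e, ∑ a, ∑ b, ∑ c, ∑ d, f a b c d e := by
  calc _ = ∑ a, ∑ b, ∑ c, ∑ e, ∑ d, f a b c d e :=
        Finset.sum_congr rfl fun a _ => Finset.sum_congr rfl fun b _ =>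
          Finset.sum_congr rfl fun c _ => Finset.sum_comm
    _ = ∑ a, ∑ b, ∑ e, ∑ c, ∑ d, f a b c d e :=
        Finset.sum_congr rfl fun a _ => Finset.sum_congr rfl fun b _ => Finset.sum_comm
    _ = ∑ a, ∑ e, ∑ b, ∑ c, ∑ d, f a b c d e :=
        Finset.sum_congr rfl fun a _ => Finset.sum_comm
    _ = _ := Finset.sum_comm

lemma sum_comm_four (f : Fin 4 → Fin 4 → Fin 4 → Fin 4 → ℂ) :
    ∑ a, ∑ b, ∑ c, ∑ d, f a b c d = ∑ c, ∑ d, ∑ a, ∑ b, f a b c d := by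
  calc _ = ∑ a, ∑ c, ∑ b, ∑ d, f a b c d :=
        Finset.sum_congr rfl fun a _ => Finset.sum_comm
    _ = ∑ c, ∑ a, ∑ b, ∑ d, f a b c d := Finset.sum_comm
    _ = ∑ c, ∑ a, ∑ d, ∑ b, f a b c d :=
        Finset.sum_congr rfl fun c _ => Finset.sum_congr rfl fun a _ => Finset.sum_comm
    _ = _ := Finset.sum_congr rfl fun c _ => Finset.sum_comm

/-- Contracting with `(n, u, u, u)` uncouples the two factors: `n` and one `u` fill the first, the
other two `u` the second, and only the summed indices link them. -/
lemma trace_curv (K : Fin 4 → Fin 4 → Fin 4 → Fin 4 → ℂ) (n u : Fin 4 → ℂ) :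
    ∑ b, ∑ r, ∑ s, ∑ t, (∑ μ, ∑ ν, K b μ s ν * K t ν r μ) * n b * u r * u s * u t
      = ∑ μ, ∑ ν, (∑ a, ∑ c, K a μ c ν * n a * u c) * (∑ a, ∑ c, K a ν c μ * u a * u c) := by
  simp only [Finset.sum_mul]
  rw [sum_comm_five]
  refine Finset.sum_congr rfl fun μ _ => ?_
  rw [sum_comm_five]
  refine Finset.sum_congr rfl fun ν _ => ?_
  refine Finset.sum_congr rfl fun b _ => ?_
  rw [Finset.sum_comm]
  refine Finset.sum_congr rfl fun s _ => ?_
  rw [Finset.sum_comm]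
  simp only [Finset.mul_sum]
  refine Finset.sum_congr rfl fun t _ => Finset.sum_congr rfl fun r _ => by ring

lemma curv_mul_apply (g : Matrix (Fin 4) (Fin 4) ℝ) (W : Tensor4) (x y : CVec) (μ ν : Fin 4) :
    (curv W x y * gC g⁻¹) μ ν = ∑ a, ∑ c, (raiseLast g W a μ c ν : ℂ) * x a * y c := by
  simp only [Matrix.mul_apply, curv, Matrix.of_apply, gC, Matrix.map_apply, raiseLast,
    Complex.ofReal_sum, Complex.ofReal_mul, Finset.sum_mul]
  rw [Finset.sum_comm]
  refine Finset.sum_congr rfl fun a _ => ?_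
  rw [Finset.sum_comm]
  refine Finset.sum_congr rfl fun c _ => Finset.sum_congr rfl fun d _ => by ring

lemma dot_raise {g : Matrix (Fin 4) (Fin 4) ℝ} (hg : IsLorentzian g) (n p : Vec) :
    dot g n (fun a => ∑ b, g⁻¹ a b * p b) = ∑ b, n b * p b := by
  have h : g * g⁻¹ = 1 := Matrix.mul_nonsing_inv g hg.det_neg.ne.isUnit
  have h1 : ∀ i, ∑ j, g i j * ∑ b, g⁻¹ j b * p b = p i := by
    intro i
    have := congrFun (congrArg (fun M => Matrix.mulVec M p) h) i
    simp only [Matrix.one_mulVec] at this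
    rw [← Matrix.mulVec_mulVec] at this
    exact this
  unfold dot
  refine Finset.sum_congr rfl fun i _ => ?_
  rw [← h1 i, Finset.mul_sum]
  refine Finset.sum_congr rfl fun j _ => by ring

/-- A trace with the inverse metric inserted is basis independent, so this form allows the passage
to a null tetrad. -/
lemma dot_supermomentum {g : Matrix (Fin 4) (Fin 4) ℝ} (hg : IsLorentzian g) (W : Tensor4)
    (u n : Vec) :
    (dot g n (supermomentum g W u) : ℂ) =
      -((curv W (toC n) (toC u) * gC g⁻¹ * curv W (toC u) (toC u) * gC g⁻¹).trace
        + (curv (hodgeDual g W) (toC n) (toC u) * gC g⁻¹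
            * curv (hodgeDual g W) (toC u) (toC u) * gC g⁻¹).trace) := by
  have h0 : supermomentum g W u = fun a => ∑ b, g⁻¹ a b *
      (-∑ r, ∑ s, ∑ t, belRobinson g W b r s t * u r * u s * u t) := by
    funext a
    simp only [supermomentum, ← Finset.sum_neg_distrib, Finset.mul_sum]
    refine Finset.sum_congr rfl fun a _ => Finset.sum_congr rfl fun b _ =>
          Finset.sum_congr rfl fun c _ => Finset.sum_congr rfl fun d _ => by ring
  rw [h0, dot_raise hg]
  have h1 : ∀ V : Tensor4, (curv V (toC n) (toC u) * gC g⁻¹ * curv V (toC u) (toC u)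
      * gC g⁻¹).trace = ∑ b, ∑ r, ∑ s, ∑ t, (∑ μ, ∑ ν, (raiseLast g V b μ s ν : ℂ)
        * raiseLast g V t ν r μ) * toC n b * toC u r * toC u s * toC u t := by
    intro V
    rw [trace_curv (fun a μ c ν => (raiseLast g V a μ c ν : ℂ)), Matrix.mul_assoc _ (curv V _ _)]
    simp only [Matrix.trace, Matrix.diag_apply, ← curv_mul_apply]
    exact Finset.sum_congr rfl fun μ _ => Matrix.mul_apply
  rw [h1, h1]
  simp only [belRobinson, toC, Complex.ofReal_sum, Complex.ofReal_mul, Complex.ofReal_neg,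
    Complex.ofReal_add, mul_neg, Finset.sum_neg_distrib, ← Finset.sum_add_distrib, Finset.mul_sum]
  congr 1
  refine Finset.sum_congr rfl fun a _ => Finset.sum_congr rfl fun b _ =>
          Finset.sum_congr rfl fun c _ => Finset.sum_congr rfl fun d _ => ?_
  simp only [Finset.sum_add_distrib]
  ring

/-! ### Volume form and Hodge dual in a null tetrad -/

/-- The Levi-Civita symbol with complex values. -/
def leviCivitaC (a b c d : Fin 4) : ℂ :=
  Matrix.det (Matrix.of ![Pi.single a (1 : ℂ), Pi.single b 1, Pi.single c 1, Pi.single d 1])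

lemma leviCivita_cast (a b c d : Fin 4) : (leviCivita a b c d : ℂ) = leviCivitaC a b c d := by
  have h : (leviCivita a b c d : ℂ) = Complex.ofRealHom (leviCivita a b c d) := rfl
  rw [h, leviCivita, RingHom.map_det, leviCivitaC]
  congr 1
  ext i j
  fin_cases i <;> simp only [RingHom.mapMatrix_apply, Matrix.map_apply, Matrix.of_apply] <;>
    simp [Pi.single_apply, eq_comm (a := j)] <;> split_ifs <;> simp_all

lemma det_rows (x y z w : Fin 4 → ℂ) :
    (Matrix.of ![x, y, z, w]).det
      = x 0 * (y 1 * (z 2 * w 3 - z 3 * w 2) - y 2 * (z 1 * w 3 - z 3 * w 1)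
          + y 3 * (z 1 * w 2 - z 2 * w 1))
        - x 1 * (y 0 * (z 2 * w 3 - z 3 * w 2) - y 2 * (z 0 * w 3 - z 3 * w 0)
          + y 3 * (z 0 * w 2 - z 2 * w 0))
        + x 2 * (y 0 * (z 1 * w 3 - z 3 * w 1) - y 1 * (z 0 * w 3 - z 3 * w 0)
          + y 3 * (z 0 * w 1 - z 1 * w 0))
        - x 3 * (y 0 * (z 1 * w 2 - z 2 * w 1) - y 1 * (z 0 * w 2 - z 2 * w 0)
          + y 2 * (z 0 * w 1 - z 1 * w 0)) := by
  simp [Matrix.det_succ_row_zero, Fin.sum_univ_succ, Fin.succAbove, Matrix.of_apply]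
  ring

/-- Multilinearity of the determinant, applied to one row at a time. -/
lemma sum_leviCivitaC (x y z w : Fin 4 → ℂ) :
    ∑ a, ∑ b, ∑ c, ∑ d, leviCivitaC a b c d * x a * y b * z c * w d
      = (Matrix.of ![x, y, z, w]).det := by
  have h4 : ∀ x y z w : Fin 4 → ℂ, ∑ d, (Matrix.of ![x, y, z, Pi.single d 1]).det * w d
      = (Matrix.of ![x, y, z, w]).det := by
    intro x y z w; simp only [det_rows, Fin.sum_univ_four]; simp; ring
  have h3 : ∀ x y z w : Fin 4 → ℂ, ∑ d, (Matrix.of ![x, y, Pi.single d 1, w]).det * z d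
      = (Matrix.of ![x, y, z, w]).det := by
    intro x y z w; simp only [det_rows, Fin.sum_univ_four]; simp; ring
  have h2 : ∀ x y z w : Fin 4 → ℂ, ∑ d, (Matrix.of ![x, Pi.single d 1, z, w]).det * y d
      = (Matrix.of ![x, y, z, w]).det := by
    intro x y z w; simp only [det_rows, Fin.sum_univ_four]; simp; ring
  have h1 : ∀ x y z w : Fin 4 → ℂ, ∑ d, (Matrix.of ![Pi.single d 1, y, z, w]).det * x d
      = (Matrix.of ![x, y, z, w]).det := by
    intro x y z w; simp only [det_rows, Fin.sum_univ_four]; simp; ring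
  rw [← h1]
  refine Finset.sum_congr rfl fun a _ => ?_
  rw [← h2, Finset.sum_mul]
  refine Finset.sum_congr rfl fun b _ => ?_
  rw [← h3, Finset.sum_mul, Finset.sum_mul]
  refine Finset.sum_congr rfl fun c _ => ?_
  rw [← h4, Finset.sum_mul, Finset.sum_mul, Finset.sum_mul]
  refine Finset.sum_congr rfl fun d _ => ?_
  rw [leviCivitaC]; ring

lemma det_frame_rows (F : Matrix (Fin 4) (Fin 4) ℂ) (i j r s : Fin 4) :
    (Matrix.of ![F i, F j, F r, F s]).det = leviCivitaC i j r s * F.det := by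
  rw [leviCivitaC, ← Matrix.det_mul]
  congr 1
  ext p q
  fin_cases p <;> simp [Matrix.mul_apply, Pi.single_apply]

/-- The volume of the complex basis given by a tetrad. -/
noncomputable def tetradVolume (g : Matrix (Fin 4) (Fin 4) ℝ) (T : Tetrad) : ℂ :=
  (Real.sqrt (-g.det) : ℂ) * T.frame.det

/-- Determinants in the Gram relation give `det(F)² det g = 1`. The tetrads carry no chosen
orientation, so the volume may be `i` or `-i`; only its square is needed. -/
lemma tetradVolume_sq {g : Matrix (Fin 4) (Fin 4) ℝ} (hg : IsLorentzian g) {T : Tetrad}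
    (hT : IsNullTetrad g T) : tetradVolume g T * tetradVolume g T = -1 := by
  have h := congrArg Matrix.det (hT.frame_gram hg)
  rw [Matrix.det_mul, Matrix.det_mul, nullGram_det, Matrix.det_transpose] at h
  have h2 : (gC g).det = (g.det : ℂ) := by
    have := RingHom.map_det Complex.ofRealHom g
    exact this.symm
  have h3 : (Real.sqrt (-g.det) : ℂ) * (Real.sqrt (-g.det) : ℂ) = -(g.det : ℂ) := by
    rw [← Complex.ofReal_mul, Real.mul_self_sqrt (by linarith [hg.det_neg])]
    push_cast; ring
  rw [h2] at h
  unfold tetradVolume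
  linear_combination (T.frame.det * T.frame.det) * h3 - h

/-- Hodge dual on the first pair of indices, in the frame of a null tetrad. -/
noncomputable def frameDual (A : Fin 4 → Fin 4 → Fin 4 → Fin 4 → ℂ) (i j k l : Fin 4) : ℂ :=
  (1 / 2) * ∑ r, ∑ s, leviCivitaC i j r s *
    (nullGram * Matrix.of (fun p q => A p q k l) * nullGram.transpose) r s

/-- On frame vectors the volume form is the Levi-Civita symbol times the volume of the frame, while
the inverse metric becomes the null Gram matrix. -/
lemma frameComp_hodgeDual {g : Matrix (Fin 4) (Fin 4) ℝ} (hg : IsLorentzian g) {T : Tetrad}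
    (hT : IsNullTetrad g T) (W : Tensor4) (i j k l : Fin 4) :
    frameComp (hodgeDual g W) T i j k l
      = tetradVolume g T * frameDual (frameComp W T) i j k l := by
  set F := T.frame with hF
  let A : Matrix (Fin 4) (Fin 4) ℂ :=
    Matrix.of fun p q => ∑ c, ∑ d, (W p q c d : ℂ) * F k c * F l d
  let V : Matrix (Fin 4) (Fin 4) ℂ :=
    Matrix.of fun r s => ∑ a, ∑ b, (volumeForm g a b r s : ℂ) * F i a * F j b
  have hA : F * A * F.transpose = Matrix.of fun p q => frameComp W T p q k l := by
    ext p q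
    simp only [A, Matrix.mul_apply, Matrix.of_apply, Matrix.transpose_apply, frameComp, evalC,
      Finset.sum_mul, Finset.mul_sum]
    rw [Finset.sum_comm]
    refine Finset.sum_congr rfl fun a _ => Finset.sum_congr rfl fun b _ =>
          Finset.sum_congr rfl fun c _ => Finset.sum_congr rfl fun d _ => by rw [← hF]; ring
  have hV : ∀ r s, (F * V * F.transpose) r s = tetradVolume g T * leviCivitaC i j r s := by
    intro r s
    have : (F * V * F.transpose) r s = (Real.sqrt (-g.det) : ℂ) *
        ∑ a, ∑ b, ∑ c, ∑ d, leviCivitaC a b c d * F i a * F j b * F r c * F s d := by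
      simp only [V, Matrix.mul_apply, Matrix.of_apply, Matrix.transpose_apply,
        Finset.sum_mul, Finset.mul_sum, volumeForm, Complex.ofReal_mul, leviCivita_cast]
      rw [Finset.sum_comm]
      calc _ = ∑ c, ∑ a, ∑ d, ∑ b, F r c * ((Real.sqrt (-g.det) : ℂ) * leviCivitaC a b c d
              * F i a * F j b) * F s d :=
            Finset.sum_congr rfl fun c _ => Finset.sum_comm
        _ = ∑ a, ∑ c, ∑ d, ∑ b, F r c * ((Real.sqrt (-g.det) : ℂ) * leviCivitaC a b c d
              * F i a * F j b) * F s d := Finset.sum_comm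
        _ = ∑ a, ∑ c, ∑ b, ∑ d, F r c * ((Real.sqrt (-g.det) : ℂ) * leviCivitaC a b c d
              * F i a * F j b) * F s d :=
            Finset.sum_congr rfl fun a _ => Finset.sum_congr rfl fun c _ => Finset.sum_comm
        _ = ∑ a, ∑ b, ∑ c, ∑ d, F r c * ((Real.sqrt (-g.det) : ℂ) * leviCivitaC a b c d
              * F i a * F j b) * F s d :=
            Finset.sum_congr rfl fun a _ => Finset.sum_comm
        _ = _ := by
            refine Finset.sum_congr rfl fun a _ => Finset.sum_congr rfl fun b _ =>
              Finset.sum_congr rfl fun c _ => Finset.sum_congr rfl fun d _ => by ring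
    rw [this, sum_leviCivitaC, det_frame_rows, tetradVolume]; ring
  have hinv : ∀ a b, ((g⁻¹ a b : ℝ) : ℂ) = gC g⁻¹ a b := fun a b => rfl
  have hcomp : frameComp (hodgeDual g W) T i j k l
      = (1 / 2) * ∑ r, ∑ s, V r s * (gC g⁻¹ * A * (gC g⁻¹).transpose) r s := by
    have h1 : ∀ r s, (gC g⁻¹ * A * (gC g⁻¹).transpose) r s
        = ∑ p, ∑ q, gC g⁻¹ r p * gC g⁻¹ s q * A p q := by
      intro r s
      simp only [Matrix.mul_apply, Matrix.transpose_apply, Finset.sum_mul]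
      rw [Finset.sum_comm]
      refine Finset.sum_congr rfl fun p _ => Finset.sum_congr rfl fun q _ => by ring
    have h2 : ∀ a b c d, ((hodgeDual g W a b c d : ℝ) : ℂ) = (1 / 2) * ∑ r, ∑ s,
        (volumeForm g a b r s : ℂ) * ∑ p, ∑ q, gC g⁻¹ r p * gC g⁻¹ s q * (W p q c d : ℂ) := by
      intro a b c d
      simp only [hodgeDual, Complex.ofReal_mul, Complex.ofReal_sum, hinv, Finset.mul_sum]
      push_cast
      refine Finset.sum_congr rfl fun a _ => Finset.sum_congr rfl fun b _ =>
          Finset.sum_congr rfl fun c _ => Finset.sum_congr rfl fun d _ => by ring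
    have h3 : ∀ r s, ∑ c, ∑ d, (∑ p, ∑ q, gC g⁻¹ r p * gC g⁻¹ s q * (W p q c d : ℂ))
        * F k c * F l d = ∑ p, ∑ q, gC g⁻¹ r p * gC g⁻¹ s q * A p q := by
      intro r s
      simp only [A, Matrix.of_apply, Finset.sum_mul, Finset.mul_sum]
      rw [← sum_comm_four]
      refine Finset.sum_congr rfl fun a _ => Finset.sum_congr rfl fun b _ =>
          Finset.sum_congr rfl fun c _ => Finset.sum_congr rfl fun d _ => by ring
    simp only [h1, ← h3]
    simp only [frameComp, evalC, h2, V, Matrix.of_apply, ← hF]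
    have h4 : ∀ (v : Fin 4 → Fin 4 → Fin 4 → Fin 4 → ℂ) (w : Fin 4 → Fin 4 → Fin 4 → Fin 4 → ℂ),
        ∑ a, ∑ b, ∑ c, ∑ d, (1 / 2 * ∑ r, ∑ s, v a b r s * w r s c d)
          * F i a * F j b * F k c * F l d
        = 1 / 2 * ∑ r, ∑ s, (∑ a, ∑ b, v a b r s * F i a * F j b)
          * ∑ c, ∑ d, w r s c d * F k c * F l d := by
      intro v w
      simp only [Finset.mul_sum, Finset.sum_mul]
      rw [sum_comm_five]
      refine Finset.sum_congr rfl fun r _ => ?_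
      rw [sum_comm_five]
      refine Finset.sum_congr rfl fun s _ => ?_
      rw [sum_comm_four]
      refine Finset.sum_congr rfl fun a _ => Finset.sum_congr rfl fun b _ =>
          Finset.sum_congr rfl fun c _ => Finset.sum_congr rfl fun d _ => by ring
    exact h4 _ _
  rw [hcomp, hT.gC_inv_eq hg, ← hF]
  have h5 : F.transpose * nullGram * F * A * (F.transpose * nullGram * F).transpose
      = F.transpose * (nullGram * (F * A * F.transpose) * nullGram.transpose) * F := by
    simp only [Matrix.transpose_mul, Matrix.transpose_transpose, Matrix.mul_assoc]
  rw [h5, sum_mul_frame_change]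
  simp only [hV, hA, frameDual, Finset.mul_sum]
  refine Finset.sum_congr rfl fun c _ => Finset.sum_congr rfl fun d _ => by ring

/-! ### Weyl symmetries for arbitrary arguments -/

section Symmetries

variable {g : Matrix (Fin 4) (Fin 4) ℝ} {W : Tensor4}

lemma IsWeylCandidate.evalC_antisymm_left (hW : IsWeylCandidate g W) (x y z w : CVec) :
    evalC W x y z w = -evalC W y x z w := by
  rw [evalC_swap_left W x]
  simp only [evalC, ← Finset.sum_neg_distrib]
  refine Finset.sum_congr rfl fun a _ => Finset.sum_congr rfl fun b _ =>
          Finset.sum_congr rfl fun c _ => Finset.sum_congr rfl fun d _ => ?_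
  rw [hW.antisymm_left b a]; push_cast; ring

lemma IsWeylCandidate.evalC_antisymm_right (hW : IsWeylCandidate g W) (x y z w : CVec) :
    evalC W x y z w = -evalC W x y w z := by
  rw [evalC_swap_right W x]
  simp only [evalC, ← Finset.sum_neg_distrib]
  refine Finset.sum_congr rfl fun a _ => Finset.sum_congr rfl fun b _ =>
          Finset.sum_congr rfl fun c _ => Finset.sum_congr rfl fun d _ => ?_
  rw [hW.antisymm_right a b d c]; push_cast; ring

lemma IsWeylCandidate.evalC_pair_symm (hW : IsWeylCandidate g W) (x y z w : CVec) :
    evalC W x y z w = evalC W z w x y := by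
  simp only [evalC]
  rw [sum_comm_four]
  refine Finset.sum_congr rfl fun a _ => Finset.sum_congr rfl fun b _ =>
          Finset.sum_congr rfl fun c _ => Finset.sum_congr rfl fun d _ => ?_
  rw [hW.pair_symm c d a b]; ring

lemma IsWeylCandidate.evalC_cyclic (hW : IsWeylCandidate g W) (x y z w : CVec) :
    evalC W x y z w + evalC W x z w y + evalC W x w y z = 0 := by
  rw [evalC_swap_right W x z w y, evalC_swap_middle _ x z y w, evalC_swap_middle W x w y z,
    evalC_swap_right _ x y w z]
  simp only [evalC, ← Finset.sum_add_distrib]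
  refine Finset.sum_eq_zero fun a _ => Finset.sum_eq_zero fun b _ => Finset.sum_eq_zero fun c _ =>
    Finset.sum_eq_zero fun d _ => ?_
  have h : (W a b c d : ℂ) + W a c d b + W a d b c = 0 := by exact_mod_cast hW.cyclic a b c d
  linear_combination (x a * y b * z c * w d) * h

lemma IsWeylCandidate.frameComp_trace (hW : IsWeylCandidate g W) (hg : IsLorentzian g)
    {T : Tetrad} (hT : IsNullTetrad g T) (i k : Fin 4) :
    -frameComp W T i 0 k 1 - frameComp W T i 1 k 0
      + frameComp W T i 2 k 3 + frameComp W T i 3 k 2 = 0 := by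
  have h0 : ∑ b, ∑ d, curv W (T.frame i) (T.frame k) b d * gC g⁻¹ b d = 0 := by
    have h1 : ∀ b d, curv W (T.frame i) (T.frame k) b d * gC g⁻¹ b d
        = ∑ a, ∑ c, T.frame i a * T.frame k c * (((g⁻¹ b d * W a b c d : ℝ)) : ℂ) := by
      intro b d
      simp only [curv, gC, Matrix.of_apply, Matrix.map_apply, Finset.sum_mul]
      refine Finset.sum_congr rfl fun a _ => Finset.sum_congr rfl fun c _ => ?_
      push_cast; ring
    simp only [h1]
    rw [sum_comm_four]
    refine Finset.sum_eq_zero fun a _ => Finset.sum_eq_zero fun c _ => ?_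
    simp only [← Finset.mul_sum, ← Complex.ofReal_sum, hW.trace_free a c]
    simp
  rw [hT.gC_inv_eq hg, sum_mul_frame_change] at h0
  simp only [mul_curv_mul_transpose_apply, Fin.sum_univ_four] at h0
  simp [nullGram] at h0
  simp only [frameComp]
  simp only [Tetrad.frame_zero, Tetrad.frame_one, Tetrad.frame_two, Tetrad.frame_three]
  linear_combination h0

end Symmetries

/-! ### Self-dual and anti-self-dual decomposition of the Weyl tensor -/

/-- Component matrix, in a null tetrad, of the self-dual bivector with component `k ∧ m`. -/
def bivV : Matrix (Fin 4) (Fin 4) ℂ := !![0, 0, 1, 0; 0, 0, 0, 0; -1, 0, 0, 0; 0, 0, 0, 0]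

/-- Component matrix, in a null tetrad, of the self-dual bivector with components `k ∧ l` and `conj m ∧ m`. -/
def bivM : Matrix (Fin 4) (Fin 4) ℂ := !![0, 1, 0, 0; -1, 0, 0, 0; 0, 0, 0, -1; 0, 0, 1, 0]

/-- Component matrix, in a null tetrad, of the self-dual bivector with component `conj m ∧ l`. -/
def bivU : Matrix (Fin 4) (Fin 4) ℂ := !![0, 0, 0, 0; 0, 0, 0, -1; 0, 0, 0, 0; 0, 1, 0, 0]

/-- Complex conjugate of the bivector `bivV`. -/
def bivV' : Matrix (Fin 4) (Fin 4) ℂ := !![0, 0, 0, 1; 0, 0, 0, 0; 0, 0, 0, 0; -1, 0, 0, 0]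

/-- Complex conjugate of the bivector `bivM`. -/
def bivM' : Matrix (Fin 4) (Fin 4) ℂ := !![0, 1, 0, 0; -1, 0, 0, 0; 0, 0, 0, 1; 0, 0, -1, 0]

/-- Complex conjugate of the bivector `bivU`. -/
def bivU' : Matrix (Fin 4) (Fin 4) ℂ := !![0, 0, 0, 0; 0, 0, -1, 0; 0, 1, 0, 0; 0, 0, 0, 0]

/-- The quadratic expression in three bivectors with the coefficients of a Weyl spinor. -/
def weylForm (V M U : Matrix (Fin 4) (Fin 4) ℂ) (φ : Fin 5 → ℂ) (i j k l : Fin 4) : ℂ :=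
  φ 0 * (V i j * V k l) + φ 1 * (V i j * M k l + M i j * V k l)
    + φ 2 * (V i j * U k l + U i j * V k l + M i j * M k l)
    + φ 3 * (U i j * M k l + M i j * U k l) + φ 4 * (U i j * U k l)

/-- Self-dual part of the Weyl tensor in a null tetrad. -/
def weylSD (φ : Fin 5 → ℂ) := weylForm bivV bivM bivU φ

/-- Anti-self-dual part of the Weyl tensor in a null tetrad. -/
def weylASD (φ : Fin 5 → ℂ) := weylForm bivV' bivM' bivU' φ

/-- The complex conjugate Weyl scalars. -/
noncomputable def weylScalarBar (W : Tensor4) (T : Tetrad) (i : Fin 5) : ℂ :=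
  conj (weylScalar W T i)

section Table

variable {g : Matrix (Fin 4) (Fin 4) ℝ} {W : Tensor4} {T : Tetrad}

lemma weylScalar_zero : weylScalar W T 0 = frameComp W T 0 2 0 2 := rfl
lemma weylScalar_one : weylScalar W T 1 = frameComp W T 0 1 0 2 := rfl
lemma weylScalar_two : weylScalar W T 2 = frameComp W T 0 2 3 1 := rfl
lemma weylScalar_three : weylScalar W T 3 = frameComp W T 0 1 3 1 := rfl
lemma weylScalar_four : weylScalar W T 4 = frameComp W T 3 1 3 1 := rfl
lemma weylScalarBar_zero : weylScalarBar W T 0 = frameComp W T 0 3 0 3 := by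
  simp [weylScalarBar, weylScalar_zero, frameComp, conj_evalC]
lemma weylScalarBar_one : weylScalarBar W T 1 = frameComp W T 0 1 0 3 := by
  simp [weylScalarBar, weylScalar_one, frameComp, conj_evalC]
lemma weylScalarBar_two : weylScalarBar W T 2 = frameComp W T 0 3 2 1 := by
  simp [weylScalarBar, weylScalar_two, frameComp, conj_evalC]
lemma weylScalarBar_three : weylScalarBar W T 3 = frameComp W T 0 1 2 1 := by
  simp [weylScalarBar, weylScalar_three, frameComp, conj_evalC]
lemma weylScalarBar_four : weylScalarBar W T 4 = frameComp W T 2 1 2 1 := by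
  simp [weylScalarBar, weylScalar_four, frameComp, conj_evalC]

lemma eq_zero_of_antisymm {D : Fin 4 → Fin 4 → ℂ} (h : ∀ i j, D i j = -D j i)
    (h01 : D 0 1 = 0) (h02 : D 0 2 = 0) (h03 : D 0 3 = 0) (h12 : D 2 1 = 0) (h13 : D 3 1 = 0)
    (h23 : D 2 3 = 0) (i j : Fin 4) : D i j = 0 := by
  have hd : ∀ i, D i i = 0 := fun i => self_eq_neg.mp (h i i)
  fin_cases i <;> fin_cases j <;> first
    | exact hd _ | assumption | (rw [h]; simp only [neg_eq_zero]; assumption)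

lemma bivector_antisymm (i j : Fin 4) : bivV i j = -bivV j i ∧ bivM i j = -bivM j i ∧
    bivU i j = -bivU j i ∧ bivV' i j = -bivV' j i ∧ bivM' i j = -bivM' j i ∧
    bivU' i j = -bivU' j i := by
  fin_cases i <;> fin_cases j <;> simp [bivV, bivM, bivU, bivV', bivM', bivU']

/-- The algebraic symmetries and the vanishing trace leave ten independent frame components: the
five Weyl scalars and their conjugates. -/
lemma frameComp_eq (hg : IsLorentzian g) (hW : IsWeylCandidate g W) (hT : IsNullTetrad g T)
    (i j k l : Fin 4) : frameComp W T i j k l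
      = weylSD (weylScalar W T) i j k l + weylASD (weylScalarBar W T) i j k l := by
  have al : ∀ i j k l, frameComp W T i j k l = -frameComp W T j i k l := fun i j k l =>
    hW.evalC_antisymm_left _ _ _ _
  have ar : ∀ i j k l, frameComp W T i j k l = -frameComp W T i j l k := fun i j k l =>
    hW.evalC_antisymm_right _ _ _ _
  have ps : ∀ i j k l, frameComp W T i j k l = frameComp W T k l i j := fun i j k l =>
    hW.evalC_pair_symm _ _ _ _
  have cy : ∀ i j k l, frameComp W T i j k l + frameComp W T i k l j + frameComp W T i l j k = 0 :=
    fun i j k l => hW.evalC_cyclic _ _ _ _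
  have tr := fun i k => hW.frameComp_trace hg hT i k
  have z : ∀ i k l, frameComp W T i i k l = 0 := fun i k l => self_eq_neg.mp (al i i k l)
  have z' : ∀ i k l, frameComp W T k l i i = 0 := fun i k l => self_eq_neg.mp (ar k l i i)
  rw [← sub_eq_zero]
  generalize hw : frameComp W T = w at *
  have e0 : weylScalar W T 0 = w 0 2 0 2 := by rw [weylScalar_zero, hw]
  have e1 : weylScalar W T 1 = w 0 1 0 2 := by rw [weylScalar_one, hw]
  have e2 : weylScalar W T 2 = w 0 2 3 1 := by rw [weylScalar_two, hw]
  have e3 : weylScalar W T 3 = w 0 1 3 1 := by rw [weylScalar_three, hw]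
  have e4 : weylScalar W T 4 = w 3 1 3 1 := by rw [weylScalar_four, hw]
  have f0 : weylScalarBar W T 0 = w 0 3 0 3 := by rw [weylScalarBar_zero, hw]
  have f1 : weylScalarBar W T 1 = w 0 1 0 3 := by rw [weylScalarBar_one, hw]
  have f2 : weylScalarBar W T 2 = w 0 3 2 1 := by rw [weylScalarBar_two, hw]
  have f3 : weylScalarBar W T 3 = w 0 1 2 1 := by rw [weylScalarBar_three, hw]
  have f4 : weylScalarBar W T 4 = w 2 1 2 1 := by rw [weylScalarBar_four, hw]
  have t00 := tr 0 0
  have t01 := tr 0 1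
  have t02 := tr 0 2
  have t03 := tr 0 3
  have t11 := tr 1 1
  have t12 := tr 1 2
  have t13 := tr 1 3
  have t22 := tr 2 2
  have t23 := tr 2 3
  have t33 := tr 3 3
  have c0 := cy 0 1 2 3
  clear tr cy
  -- Antisymmetry in each pair reduces everything to these six by six components. The ten traces and
  -- the single cyclic identity with four different indices then suffice, together with pair
  -- symmetry.
  have leaf : ∀ a b, (a, b) ∈ [((0 : Fin 4), (1 : Fin 4)), (0, 2), (0, 3), (2, 1), (3, 1), (2, 3)] →
      ∀ c d, (c, d) ∈ [((0 : Fin 4), (1 : Fin 4)), (0, 2), (0, 3), (2, 1), (3, 1), (2, 3)] →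
      w a b c d - (weylSD (weylScalar W T) a b c d + weylASD (weylScalarBar W T) a b c d) = 0 := by
    intro a b hab c d hcd
    simp only [List.mem_cons, Prod.mk.injEq, List.not_mem_nil, or_false] at hab hcd
    simp only [weylSD, weylASD, weylForm, e0, e1, e2, e3, e4, f0, f1, f2, f3, f4]
    rcases hab with ⟨rfl, rfl⟩ | ⟨rfl, rfl⟩ | ⟨rfl, rfl⟩ | ⟨rfl, rfl⟩ | ⟨rfl, rfl⟩ | ⟨rfl, rfl⟩ <;>
    rcases hcd with ⟨rfl, rfl⟩ | ⟨rfl, rfl⟩ | ⟨rfl, rfl⟩ | ⟨rfl, rfl⟩ | ⟨rfl, rfl⟩ | ⟨rfl, rfl⟩ <;>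
    simp [bivV, bivM, bivU, bivV', bivM', bivU'] <;> grind
  have inner : ∀ a b, (a, b) ∈ [((0 : Fin 4), (1 : Fin 4)), (0, 2), (0, 3), (2, 1), (3, 1), (2, 3)] →
      ∀ c d, w a b c d - (weylSD (weylScalar W T) a b c d + weylASD (weylScalarBar W T) a b c d)
        = 0 := by
    intro a b hab c d
    refine eq_zero_of_antisymm (D := fun c d => w a b c d
      - (weylSD (weylScalar W T) a b c d + weylASD (weylScalarBar W T) a b c d)) ?_
      (leaf a b hab _ _ (by simp)) (leaf a b hab _ _ (by simp)) (leaf a b hab _ _ (by simp))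
      (leaf a b hab _ _ (by simp)) (leaf a b hab _ _ (by simp)) (leaf a b hab _ _ (by simp)) c d
    intro c d
    obtain ⟨h1, h2, h3, h4, h5, h6⟩ := bivector_antisymm c d
    simp only [ar a b c d, weylSD, weylASD, weylForm, h1, h2, h3, h4, h5, h6]
    ring
  refine eq_zero_of_antisymm (D := fun i j => w i j k l
      - (weylSD (weylScalar W T) i j k l + weylASD (weylScalarBar W T) i j k l)) ?_
      (inner _ _ (by simp) k l) (inner _ _ (by simp) k l) (inner _ _ (by simp) k l)
      (inner _ _ (by simp) k l) (inner _ _ (by simp) k l) (inner _ _ (by simp) k l) i j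
  intro a b
  obtain ⟨h1, h2, h3, h4, h5, h6⟩ := bivector_antisymm a b
  simp only [al a b k l, weylSD, weylASD, weylForm, h1, h2, h3, h4, h5, h6]
  ring

end Table

/-! ### Duality acting on the bivectors -/

/-- Hodge dual of a bivector in a null tetrad, up to the volume of the tetrad. -/
noncomputable def bivDual (B : Matrix (Fin 4) (Fin 4) ℂ) (i j : Fin 4) : ℂ :=
  (1 / 2) * ∑ r, ∑ s, leviCivitaC i j r s * (nullGram * B * nullGram.transpose) r s

lemma bivDual_add (A B : Matrix (Fin 4) (Fin 4) ℂ) (i j : Fin 4) :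
    bivDual (A + B) i j = bivDual A i j + bivDual B i j := by
  simp only [bivDual, Matrix.add_mul, Matrix.add_apply, mul_add,
    Finset.sum_add_distrib]

lemma bivDual_smul (c : ℂ) (B : Matrix (Fin 4) (Fin 4) ℂ) (i j : Fin 4) :
    bivDual (c • B) i j = c * bivDual B i j := by
  simp only [bivDual, Matrix.mul_smul, Matrix.smul_mul, Matrix.smul_apply, smul_eq_mul,
    Finset.mul_sum]
  refine Finset.sum_congr rfl fun r _ => Finset.sum_congr rfl fun s _ => by ring

lemma bivDual_explicit (B : Matrix (Fin 4) (Fin 4) ℂ) (i j : Fin 4) :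
    bivDual B i j = 1 / 2 * !![0, B 3 2 - B 2 3, B 0 2 - B 2 0, B 3 0 - B 0 3;
      B 2 3 - B 3 2, 0, B 2 1 - B 1 2, B 1 3 - B 3 1;
      B 2 0 - B 0 2, B 1 2 - B 2 1, 0, B 1 0 - B 0 1;
      B 0 3 - B 3 0, B 3 1 - B 1 3, B 0 1 - B 1 0, 0] i j := by
  have h : nullGram * B * nullGram.transpose =
      !![B 1 1, B 1 0, -B 1 3, -B 1 2; B 0 1, B 0 0, -B 0 3, -B 0 2;
        -B 3 1, -B 3 0, B 3 3, B 3 2; -B 2 1, -B 2 0, B 2 3, B 2 2] := by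
    ext r s
    fin_cases r <;> fin_cases s <;>
      simp [nullGram, Matrix.mul_apply, Fin.sum_univ_four, Matrix.vecMul, dotProduct]
  rw [bivDual, h]
  fin_cases i <;> fin_cases j <;>
    simp [Fin.sum_univ_four, leviCivitaC, det_rows] <;> ring

/-- The unprimed bivectors have eigenvalue `1` and their conjugates `-1`; this is what makes the
dual act by a scalar on each half of the Weyl tensor. -/
lemma bivDual_bivectors (i j : Fin 4) :
    bivDual bivV i j = bivV i j ∧ bivDual bivM i j = bivM i j ∧ bivDual bivU i j = bivU i j ∧
    bivDual bivV' i j = -bivV' i j ∧ bivDual bivM' i j = -bivM' i j ∧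
    bivDual bivU' i j = -bivU' i j := by
  simp only [bivDual_explicit]
  fin_cases i <;> fin_cases j <;>
    simp [bivV, bivM, bivU, bivV', bivM', bivU'] <;> norm_num

lemma bivDual_weylForm {V M U : Matrix (Fin 4) (Fin 4) ℂ} {ε : ℂ} {i j : Fin 4}
    (hV : bivDual V i j = ε * V i j) (hM : bivDual M i j = ε * M i j)
    (hU : bivDual U i j = ε * U i j) (φ : Fin 5 → ℂ) (k l : Fin 4) :
    bivDual (Matrix.of fun p q => weylForm V M U φ p q k l) i j
      = ε * weylForm V M U φ i j k l := by
  have h : (Matrix.of fun p q => weylForm V M U φ p q k l)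
      = (φ 0 * V k l + φ 1 * M k l + φ 2 * U k l) • V
        + (φ 1 * V k l + φ 2 * M k l + φ 3 * U k l) • M
        + (φ 2 * V k l + φ 3 * M k l + φ 4 * U k l) • U := by
    ext p q
    simp only [Matrix.of_apply, weylForm, Matrix.add_apply, Matrix.smul_apply, smul_eq_mul]
    ring
  rw [h, bivDual_add, bivDual_add, bivDual_smul, bivDual_smul, bivDual_smul, hV, hM, hU, weylForm]
  ring

/-! ### The Bel-Robinson tensor in spinor components -/

section BelRobinson

variable {g : Matrix (Fin 4) (Fin 4) ℝ} {W : Tensor4} {T : Tetrad}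

lemma frameComp_hodgeDual_eq (hg : IsLorentzian g) (hW : IsWeylCandidate g W)
    (hT : IsNullTetrad g T) (i j k l : Fin 4) :
    frameComp (hodgeDual g W) T i j k l = tetradVolume g T *
      (weylSD (weylScalar W T) i j k l - weylASD (weylScalarBar W T) i j k l) := by
  rw [frameComp_hodgeDual hg hT]
  congr 1
  obtain ⟨h1, h2, h3, h4, h5, h6⟩ := bivDual_bivectors i j
  have h : frameDual (frameComp W T) i j k l
      = bivDual ((Matrix.of fun p q => weylSD (weylScalar W T) p q k l)
          + (Matrix.of fun p q => weylASD (weylScalarBar W T) p q k l)) i j := by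
    simp only [frameDual, bivDual]
    congr! 7 with r _ s _
    ext p q
    exact frameComp_eq hg hW hT p q k l
  rw [h, bivDual_add, weylSD, weylASD,
    bivDual_weylForm (ε := 1) (by rw [h1, one_mul]) (by rw [h2, one_mul]) (by rw [h3, one_mul]),
    bivDual_weylForm (ε := -1) (by rw [h4]; ring) (by rw [h5]; ring) (by rw [h6]; ring)]
  ring

/-- The matrix `A(X, ·, Y, ·)` of a tensor given by its components. -/
def slotMatrix (A : Fin 4 → Fin 4 → Fin 4 → Fin 4 → ℂ) (X Y : Fin 4 → ℂ) :
    Matrix (Fin 4) (Fin 4) ℂ :=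
  Matrix.of fun i j => ∑ a, ∑ c, A a i c j * X a * Y c

lemma frame_mul_curv (hg : IsLorentzian g) (hT : IsNullTetrad g T) (V : Tensor4) (x y : CVec) :
    T.frame * curv V x y * T.frame.transpose
      = slotMatrix (frameComp V T) (T.coord g x) (T.coord g y) := by
  ext i j
  rw [mul_curv_mul_transpose_apply]
  conv_lhs => rw [hT.eq_coord_vecMul hg x, hT.eq_coord_vecMul hg y]
  simp only [evalC_vecMul_first, evalC_vecMul_third, slotMatrix, Matrix.of_apply, frameComp,
    Finset.mul_sum]
  rw [Finset.sum_comm]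
  refine Finset.sum_congr rfl fun r _ => Finset.sum_congr rfl fun s _ => by ring

/-- Contraction of one pair of spinor indices with a vector given by its components in a null
tetrad. -/
def spinContract (X : Fin 4 → ℂ) (Φ : ℕ → ℕ → ℂ) (i j : ℕ) : ℂ :=
  X 0 * Φ i j + X 2 * Φ i (j + 1) + X 3 * Φ (i + 1) j + X 1 * Φ (i + 1) (j + 1)

/-- The Bel-Robinson tensor `4 Ψ_{ABCD} Ψ̄_{A'B'C'D'}` evaluated at `(n, u, u, u)`. -/
def belRobinsonForm (φ ψ : Fin 5 → ℂ) (N X : Fin 4 → ℂ) : ℂ :=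
  4 * spinContract N (spinContract X (spinContract X (spinContract X
    fun i j => φ (Fin.ofNat 5 i) * ψ (Fin.ofNat 5 j)))) 0 0

/-- `weylForm` with both bivector pairs contracted on their first index. -/
def slotForm (v m w v' m' w' : Fin 4 → ℂ) (φ : Fin 5 → ℂ) (i j : Fin 4) : ℂ :=
  v i * (φ 0 * v' j + φ 1 * m' j + φ 2 * w' j) + m i * (φ 1 * v' j + φ 2 * m' j + φ 3 * w' j)
    + w i * (φ 2 * v' j + φ 3 * m' j + φ 4 * w' j)

lemma slotMatrix_weylForm (V M U : Matrix (Fin 4) (Fin 4) ℂ) (φ : Fin 5 → ℂ) (X Y : Fin 4 → ℂ) :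
    slotMatrix (weylForm V M U φ) X Y = Matrix.of (slotForm (Matrix.vecMul X V) (Matrix.vecMul X M)
      (Matrix.vecMul X U) (Matrix.vecMul Y V) (Matrix.vecMul Y M) (Matrix.vecMul Y U) φ) := by
  ext i j
  simp only [slotMatrix, Matrix.of_apply, weylForm, slotForm, Matrix.vecMul, dotProduct,
    Fin.sum_univ_four]
  ring

/-- A self-dual factor contracted with an anti-self-dual one leaves the product of a spinor and a
conjugate spinor, each with all its indices free. In components this is a polynomial identity. -/
lemma trace_slotMatrix (φ ψ : Fin 5 → ℂ) (N X : Fin 4 → ℂ) :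
    2 * ((slotMatrix (weylSD φ) N X * nullGram * slotMatrix (weylASD ψ) X X * nullGram).trace
      + (slotMatrix (weylASD ψ) N X * nullGram * slotMatrix (weylSD φ) X X * nullGram).trace)
      = belRobinsonForm φ ψ N X := by
  have hV : ∀ X : Fin 4 → ℂ, Matrix.vecMul X bivV = ![-X 2, 0, X 0, 0] := by
    intro X; ext i; fin_cases i <;> simp [bivV, Matrix.vecMul, dotProduct, Fin.sum_univ_four]
  have hM : ∀ X : Fin 4 → ℂ, Matrix.vecMul X bivM = ![-X 1, X 0, X 3, -X 2] := by
    intro X; ext i; fin_cases i <;> simp [bivM, Matrix.vecMul, dotProduct, Fin.sum_univ_four]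
  have hU : ∀ X : Fin 4 → ℂ, Matrix.vecMul X bivU = ![0, X 3, 0, -X 1] := by
    intro X; ext i; fin_cases i <;> simp [bivU, Matrix.vecMul, dotProduct, Fin.sum_univ_four]
  have hV' : ∀ X : Fin 4 → ℂ, Matrix.vecMul X bivV' = ![-X 3, 0, 0, X 0] := by
    intro X; ext i; fin_cases i <;> simp [bivV', Matrix.vecMul, dotProduct, Fin.sum_univ_four]
  have hM' : ∀ X : Fin 4 → ℂ, Matrix.vecMul X bivM' = ![-X 1, X 0, -X 3, X 2] := by
    intro X; ext i; fin_cases i <;> simp [bivM', Matrix.vecMul, dotProduct, Fin.sum_univ_four]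
  have hU' : ∀ X : Fin 4 → ℂ, Matrix.vecMul X bivU' = ![0, X 2, -X 1, 0] := by
    intro X; ext i; fin_cases i <;> simp [bivU', Matrix.vecMul, dotProduct, Fin.sum_univ_four]
  have htr : ∀ A B : Matrix (Fin 4) (Fin 4) ℂ, (A * nullGram * B * nullGram).trace
      = ∑ i, ∑ j, A i j * !![B 1 1, B 0 1, -B 3 1, -B 2 1; B 1 0, B 0 0, -B 3 0, -B 2 0;
          -B 1 3, -B 0 3, B 3 3, B 2 3; -B 1 2, -B 0 2, B 3 2, B 2 2] i j := by
    intro A B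
    simp [Matrix.trace, Matrix.mul_apply, nullGram, Fin.sum_univ_four]
    ring
  simp only [weylSD, weylASD, slotMatrix_weylForm, hV, hM, hU, hV', hM', hU', htr]
  have p0 : ∀ φ : Fin 5 → ℂ, φ (Fin.ofNat 5 0) = φ 0 := fun φ => rfl
  have p1 : ∀ φ : Fin 5 → ℂ, φ (Fin.ofNat 5 1) = φ 1 := fun φ => rfl
  have p2 : ∀ φ : Fin 5 → ℂ, φ (Fin.ofNat 5 2) = φ 2 := fun φ => rfl
  have p3 : ∀ φ : Fin 5 → ℂ, φ (Fin.ofNat 5 3) = φ 3 := fun φ => rfl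
  have p4 : ∀ φ : Fin 5 → ℂ, φ (Fin.ofNat 5 4) = φ 4 := fun φ => rfl
  simp only [belRobinsonForm, spinContract, zero_add, one_add_one_eq_two, Nat.reduceAdd,
    p0, p1, p2, p3, p4]
  simp [Fin.sum_univ_four, slotForm]
  ring

/-- With `S` and `A` the self-dual and anti-self-dual parts, `W` is `S + A` and its dual is `v (S -
A)` with `v² = -1`. The products `SS` and `AA` cancel and the mixed ones double. -/
lemma dot_supermomentum_eq (hg : IsLorentzian g) (hW : IsWeylCandidate g W)
    (hT : IsNullTetrad g T) (u n : Vec) :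
    (dot g n (supermomentum g W u) : ℂ) = -belRobinsonForm (weylScalar W T) (weylScalarBar W T)
      (T.coord g (toC n)) (T.coord g (toC u)) := by
  have hS : ∀ X Y, slotMatrix (frameComp W T) X Y = slotMatrix (weylSD (weylScalar W T)) X Y
      + slotMatrix (weylASD (weylScalarBar W T)) X Y := by
    intro X Y
    ext i j
    simp only [slotMatrix, Matrix.of_apply, frameComp_eq hg hW hT, add_mul,
      Finset.sum_add_distrib, Matrix.add_apply]
  have hD : ∀ X Y, slotMatrix (frameComp (hodgeDual g W) T) X Y
      = tetradVolume g T • (slotMatrix (weylSD (weylScalar W T)) X Y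
        - slotMatrix (weylASD (weylScalarBar W T)) X Y) := by
    intro X Y
    ext i j
    simp only [slotMatrix, Matrix.of_apply, frameComp_hodgeDual_eq hg hW hT, Matrix.smul_apply,
      Matrix.sub_apply, ← Finset.sum_sub_distrib, smul_eq_mul, Finset.mul_sum]
    refine Finset.sum_congr rfl fun r _ => Finset.sum_congr rfl fun s _ => by ring
  rw [dot_supermomentum hg, hT.gC_inv_eq hg, trace_frame_change, trace_frame_change]
  simp only [frame_mul_curv hg hT, hS, hD]
  rw [← trace_slotMatrix]
  simp only [Matrix.add_mul, Matrix.mul_add, Matrix.sub_mul, Matrix.mul_sub, Matrix.smul_mul,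
    Matrix.mul_smul, Matrix.trace_add, Matrix.trace_sub, Matrix.trace_smul, smul_eq_mul]
  have h := tetradVolume_sq hg hT
  generalize weylSD (weylScalar W T) = S
  generalize weylASD (weylScalarBar W T) = A
  generalize T.coord g (toC n) = N
  generalize T.coord g (toC u) = X
  linear_combination (-(slotMatrix S N X * nullGram * slotMatrix S X X * nullGram).trace
    + (slotMatrix S N X * nullGram * slotMatrix A X X * nullGram).trace
    + (slotMatrix A N X * nullGram * slotMatrix S X X * nullGram).trace
    - (slotMatrix A N X * nullGram * slotMatrix A X X * nullGram).trace) * h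

end BelRobinson

/-! ### Null rotations and the components of `u` -/

/-- The tetrad with the two real null vectors exchanged. -/
def Tetrad.swap (T : Tetrad) : Tetrad := ⟨T.l, T.k, T.m⟩

section Kinematics

variable {g : Matrix (Fin 4) (Fin 4) ℝ} {T : Tetrad}

lemma IsNullTetrad.swap (hg : IsLorentzian g) (hT : IsNullTetrad g T) : IsNullTetrad g T.swap :=
  ⟨hT.ll, hT.kk, (dot_comm hg _ _).trans hT.kl, hT.mm, hT.mmbar, hT.lm, hT.km⟩

lemma IsFutureTetrad.swap (hg : IsLorentzian g) {u : Vec} (hT : IsFutureTetrad g u T) :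
    IsFutureTetrad g u T.swap :=
  ⟨hT.null.swap hg, hT.future_l, hT.future_k⟩

lemma vecMul_frame (T : Tetrad) (a b c d : ℂ) (i : Fin 4) :
    Matrix.vecMul ![a, b, c, d] T.frame i
      = a * T.k i + b * T.l i + c * T.m i + d * conj (T.m i) := by
  simp [Matrix.vecMul, dotProduct, Fin.sum_univ_four, toC, cconj]

lemma toC_k_eq (T : Tetrad) : toC T.k = Matrix.vecMul ![1, 0, 0, 0] T.frame := by
  funext i; rw [vecMul_frame]; simp [toC]

lemma toC_l_eq (T : Tetrad) : toC T.l = Matrix.vecMul ![0, 1, 0, 0] T.frame := by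
  funext i; rw [vecMul_frame]; simp [toC]

lemma m_eq (T : Tetrad) : T.m = Matrix.vecMul ![0, 0, 1, 0] T.frame := by
  funext i; rw [vecMul_frame]; simp

lemma cconj_m_eq (T : Tetrad) : cconj T.m = Matrix.vecMul ![0, 0, 0, 1] T.frame := by
  funext i; rw [vecMul_frame]; simp [cconj]

lemma add_conj_eq (z : ℂ) : ((2 * z.re : ℝ) : ℂ) = z + conj z := (Complex.add_conj z).symm

lemma toC_rotFirst_k (T : Tetrad) (c : ℂ) :
    toC (T.rotFirst c).k = Matrix.vecMul ![1, c * conj c, c, conj c] T.frame := by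
  funext i
  rw [vecMul_frame]
  simp only [toC, Tetrad.rotFirst]
  rw [Complex.ofReal_add, Complex.ofReal_add, add_conj_eq, Complex.ofReal_mul,
    Complex.normSq_eq_conj_mul_self, map_mul]
  ring

lemma rotFirst_m (T : Tetrad) (c : ℂ) :
    (T.rotFirst c).m = Matrix.vecMul ![0, conj c, 1, 0] T.frame := by
  funext i
  rw [vecMul_frame]
  simp only [Tetrad.rotFirst]
  ring

lemma cconj_rotFirst_m (T : Tetrad) (c : ℂ) :
    cconj (T.rotFirst c).m = Matrix.vecMul ![0, c, 0, 1] T.frame := by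
  funext i
  rw [vecMul_frame]
  simp only [Tetrad.rotFirst, cconj, map_add, map_mul, Complex.conj_conj, Complex.conj_ofReal]
  ring

lemma IsNullTetrad.rotFirst (hg : IsLorentzian g) (hT : IsNullTetrad g T) (c : ℂ) :
    IsNullTetrad g (T.rotFirst c) := by
  have hl : toC (T.rotFirst c).l = Matrix.vecMul ![0, 1, 0, 0] T.frame := toC_l_eq T
  constructor
  · rw [← Complex.ofReal_inj, ← cdot_toC, toC_rotFirst_k, cdot_vecMul_frame hg hT]; simp; ring
  · rw [← Complex.ofReal_inj, ← cdot_toC, hl, cdot_vecMul_frame hg hT]; simp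
  · rw [← Complex.ofReal_inj, ← cdot_toC, toC_rotFirst_k, hl, cdot_vecMul_frame hg hT]; simp
  · rw [rotFirst_m, cdot_vecMul_frame hg hT]; simp
  · rw [cconj_rotFirst_m, rotFirst_m, cdot_vecMul_frame hg hT]; simp
  · rw [toC_rotFirst_k, rotFirst_m, cdot_vecMul_frame hg hT]; simp
  · rw [hl, rotFirst_m, cdot_vecMul_frame hg hT]; simp

/-- The rotation that keeps `k` is definitionally the one that keeps `l`, conjugated by the exchange
of `k` and `l`; later facts about it are obtained in the same way. -/
lemma IsNullTetrad.rotSecond (hg : IsLorentzian g) (hT : IsNullTetrad g T) (c : ℂ) :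
    IsNullTetrad g (T.rotSecond c) := ((hT.swap hg).rotFirst hg c).swap hg

lemma coord_vecMul (hg : IsLorentzian g) (hT : IsNullTetrad g T) (X : Fin 4 → ℂ) :
    T.coord g (Matrix.vecMul X T.frame) = X := by
  have h0 : cdot g (Matrix.vecMul X T.frame) (toC T.l) = -X 0 := by
    rw [toC_l_eq, cdot_vecMul_frame hg hT]; simp
  have h1 : cdot g (Matrix.vecMul X T.frame) (toC T.k) = -X 1 := by
    rw [toC_k_eq, cdot_vecMul_frame hg hT]; simp
  have h2 : cdot g (Matrix.vecMul X T.frame) (cconj T.m) = X 2 := by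
    rw [cconj_m_eq, cdot_vecMul_frame hg hT]; simp
  have h3 : cdot g (Matrix.vecMul X T.frame) T.m = X 3 := by
    conv_lhs => rw [m_eq T]
    rw [cdot_vecMul_frame hg hT]; simp
  rw [Tetrad.coord, h0, h1, h2, h3]
  funext i
  fin_cases i <;> simp

lemma coord_toC (T : Tetrad) (x : Vec) : T.coord g (toC x)
    = ![(compA g x T : ℂ), (compB g x T : ℂ), compD g x T, conj (compD g x T)] := by
  simp only [Tetrad.coord, compA, compB, compD, cdot_toC, conj_cdot, cconj_toC, cconj_cconj,
    Complex.ofReal_neg]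

lemma IsNullTetrad.eq_comp (hg : IsLorentzian g) (hT : IsNullTetrad g T) (x : Vec) (i : Fin 4) :
    (x i : ℂ) = compA g x T * T.k i + compB g x T * T.l i + compD g x T * T.m i
      + conj (compD g x T) * conj (T.m i) := by
  have h := congrFun (hT.eq_coord_vecMul hg (toC x)) i
  rwa [coord_toC, vecMul_frame] at h

lemma dot_eq_coord (hg : IsLorentzian g) (hT : IsNullTetrad g T) (x y : Vec) :
    (dot g x y : ℂ) = -(T.coord g (toC x) 0 * T.coord g (toC y) 1)
      - T.coord g (toC x) 1 * T.coord g (toC y) 0 + T.coord g (toC x) 2 * T.coord g (toC y) 3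
      + T.coord g (toC x) 3 * T.coord g (toC y) 2 := by
  rw [← cdot_toC]
  conv_lhs => rw [hT.eq_coord_vecMul hg (toC x), hT.eq_coord_vecMul hg (toC y)]
  exact cdot_vecMul_frame hg hT _ _

lemma dot_self_eq_comp (hg : IsLorentzian g) (hT : IsNullTetrad g T) (x : Vec) :
    dot g x x = -2 * (compA g x T * compB g x T - Complex.normSq (compD g x T)) := by
  rw [← Complex.ofReal_inj, dot_eq_coord hg hT, coord_toC]
  push_cast
  rw [Complex.normSq_eq_conj_mul_self]
  simp
  ring

lemma comp_unit (hg : IsLorentzian g) (hT : IsNullTetrad g T) {u : Vec} (hu : dot g u u = -1) :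
    compA g u T * compB g u T - Complex.normSq (compD g u T) = 1 / 2 := by
  have := dot_self_eq_comp hg hT u
  linarith

lemma third_eq (hg : IsLorentzian g) (hT : IsNullTetrad g T) {u : Vec} (hu : dot g u u = -1) :
    third g u T = 4 / 3 * (compA g u T * compB g u T) - 1 / 2 := by
  have := comp_unit hg hT hu
  rw [third]; linarith

lemma whole_eq (hg : IsLorentzian g) (hT : IsNullTetrad g T) {u : Vec} (hu : dot g u u = -1) :
    whole g u T = 2 * (compA g u T * compB g u T) - 1 / 2 := by
  have := comp_unit hg hT hu
  rw [whole]; linarith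

lemma IsFutureTetrad.compA_pos (hg : IsLorentzian g) {u : Vec} (hT : IsFutureTetrad g u T) :
    0 < compA g u T := by
  have := hT.future_l
  rw [IsFuture, dot_comm hg] at this
  rw [compA]; linarith

lemma IsFutureTetrad.compB_pos (hg : IsLorentzian g) {u : Vec} (hT : IsFutureTetrad g u T) :
    0 < compB g u T := by
  have := hT.future_k
  rw [IsFuture, dot_comm hg] at this
  rw [compB]; linarith

lemma IsFutureTetrad.third_pos (hg : IsLorentzian g) {u : Vec} (hT : IsFutureTetrad g u T) :
    0 < third g u T := by
  have h1 := mul_pos (hT.compA_pos hg) (hT.compB_pos hg)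
  have h2 := Complex.normSq_nonneg (compD g u T)
  rw [third]; linarith

lemma coord_rotFirst_k (hg : IsLorentzian g) (hT : IsNullTetrad g T) (c : ℂ) :
    T.coord g (toC (T.rotFirst c).k) = ![1, c * conj c, c, conj c] := by
  rw [toC_rotFirst_k, coord_vecMul hg hT]

lemma IsFutureTetrad.rotFirst (hg : IsLorentzian g) {u : Vec} (hu : dot g u u = -1)
    (hT : IsFutureTetrad g u T) (c : ℂ) : IsFutureTetrad g u (T.rotFirst c) := by
  refine ⟨hT.null.rotFirst hg c, ?_, hT.future_l⟩
  -- Completing the square in `c`, with `ab = |d|² + 1/2`, makes the new component `b` visibly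
  -- positive.
  have h : compA g u T * -dot g (T.rotFirst c).k u
      = Complex.normSq (c * compA g u T - compD g u T) + 1 / 2 := by
    rw [← comp_unit hg hT.null hu, ← Complex.ofReal_inj]
    push_cast
    rw [dot_eq_coord hg hT.null, coord_rotFirst_k hg hT.null, coord_toC,
      Complex.normSq_eq_conj_mul_self, Complex.normSq_eq_conj_mul_self]
    simp
    ring
  have h1 := Complex.normSq_nonneg (c * compA g u T - compD g u T)
  have h2 : 0 < compA g u T * -dot g (T.rotFirst c).k u := by rw [h]; linarith
  have h3 := (mul_pos_iff_of_pos_left (hT.compA_pos hg)).mp h2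
  rw [IsFuture]; linarith

lemma IsFutureTetrad.rotSecond (hg : IsLorentzian g) {u : Vec} (hu : dot g u u = -1)
    (hT : IsFutureTetrad g u T) (c : ℂ) : IsFutureTetrad g u (T.rotSecond c) :=
  ((hT.swap hg).rotFirst hg hu c).swap hg

lemma toC_injective : Function.Injective toC := fun x y h => by
  funext i; exact Complex.ofReal_injective (congrFun h i)

lemma coord_smul (r : ℝ) (x : Vec) (i : Fin 4) :
    T.coord g (toC (r • x)) i = r * T.coord g (toC x) i := by
  have : toC (r • x) = (r : ℂ) • toC x := by funext i; simp [toC]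
  rw [this, Tetrad.coord, cdot_smul_left, cdot_smul_left, cdot_smul_left, cdot_smul_left]
  fin_cases i <;> simp [Tetrad.coord]

lemma ext_coord (hg : IsLorentzian g) (hT : IsNullTetrad g T) {x y : Vec}
    (h : T.coord g (toC x) = T.coord g (toC y)) : x = y :=
  toC_injective (by rw [hT.eq_coord_vecMul hg (toC x), h, ← hT.eq_coord_vecMul hg (toC y)])

lemma existsUnique_rotFirst (hg : IsLorentzian g) {u : Vec} (hT : IsNullTetrad g T) {x : Vec}
    (hx : dot g x x = 0) (hxu : IsFuture g u x) (hxl : ¬SameDirection x T.l) :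
    ∃! c : ℂ, SameDirection (T.rotFirst c).k x := by
  have hn := dot_self_eq_comp hg hT x
  have hA : compA g x T ≠ 0 := by
    -- If the component of the null vector `x` along `k` vanishes, so does the one along `m`, and
    -- `x` is a multiple of `l`; being future oriented, it is not zero.
    intro hA
    rw [hx, hA] at hn
    have hD : compD g x T = 0 := Complex.normSq_eq_zero.mp (by linarith)
    have hxe : x = compB g x T • T.l := by
      apply toC_injective
      funext i
      have := hT.eq_comp hg x i
      rw [hA, hD] at this
      simpa [toC] using this
    refine hxl ⟨_, ?_, hxe⟩
    intro h0
    rw [h0, zero_smul] at hxe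
    rw [IsFuture, hxe] at hxu
    simp [dot] at hxu
  have hAc : (compA g x T : ℂ) ≠ 0 := by exact_mod_cast hA
  have hAB : (compA g x T : ℂ) * compB g x T = compD g x T * conj (compD g x T) := by
    rw [mul_comm (compD g x T), ← Complex.normSq_eq_conj_mul_self]
    rw [hx] at hn
    exact_mod_cast (by linarith : compA g x T * compB g x T = Complex.normSq (compD g x T))
  refine ⟨compD g x T / compA g x T, ⟨(compA g x T)⁻¹, inv_ne_zero hA, ?_⟩, ?_⟩
  · apply ext_coord hg hT
    rw [coord_rotFirst_k hg hT]
    funext i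
    rw [coord_smul, coord_toC]
    fin_cases i
    · simp [hAc]
    · simp
      field_simp
      linear_combination -hAB
    · simp; ring
    · simp; ring
  · rintro c ⟨r, hr, h⟩
    have h0 := congrArg (fun y => T.coord g (toC y)) h
    simp only [coord_rotFirst_k hg hT] at h0
    have h1 := congrFun h0 0
    have h2 := congrFun h0 2
    rw [coord_smul, coord_toC] at h1 h2
    simp at h1 h2
    rw [h2, eq_div_iff hAc]
    linear_combination (-compD g x T) * h1

lemma existsUnique_rotSecond (hg : IsLorentzian g) {u : Vec} (hT : IsNullTetrad g T) {x : Vec}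
    (hx : dot g x x = 0) (hxu : IsFuture g u x) (hxk : ¬SameDirection x T.k) :
    ∃! c : ℂ, SameDirection (T.rotSecond c).l x :=
  existsUnique_rotFirst hg (hT.swap hg) hx hxu hxk

end Kinematics

/-! ### Weyl scalars under null rotations and principal directions -/

section Scalars

variable {g : Matrix (Fin 4) (Fin 4) ℝ} {W : Tensor4} {T : Tetrad}

/-- Contraction of a bivector with two vectors. -/
def bivApply (B : Matrix (Fin 4) (Fin 4) ℂ) (X Y : Fin 4 → ℂ) : ℂ := ∑ i, X i * ∑ j, Y j * B i j

lemma sum_weylForm (V M U : Matrix (Fin 4) (Fin 4) ℂ) (φ : Fin 5 → ℂ) (X Y : Fin 4 → ℂ) :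
    ∑ i, X i * ∑ j, Y j * ∑ k, X k * ∑ l, Y l * weylForm V M U φ i j k l
      = φ 0 * bivApply V X Y ^ 2 + 2 * φ 1 * (bivApply V X Y * bivApply M X Y)
        + φ 2 * (2 * (bivApply V X Y * bivApply U X Y) + bivApply M X Y ^ 2)
        + 2 * φ 3 * (bivApply U X Y * bivApply M X Y) + φ 4 * bivApply U X Y ^ 2 := by
  have h : ∀ i j, ∑ k, X k * ∑ l, Y l * weylForm V M U φ i j k l
      = (φ 0 * bivApply V X Y + φ 1 * bivApply M X Y + φ 2 * bivApply U X Y) * V i j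
        + (φ 1 * bivApply V X Y + φ 2 * bivApply M X Y + φ 3 * bivApply U X Y) * M i j
        + (φ 2 * bivApply V X Y + φ 3 * bivApply M X Y + φ 4 * bivApply U X Y) * U i j := by
    intro i j
    simp only [bivApply, weylForm, Finset.mul_sum, Finset.sum_mul, ← Finset.sum_add_distrib]
    refine Finset.sum_congr rfl fun k _ => Finset.sum_congr rfl fun l _ => by ring
  simp only [h]
  have h' : ∀ p q r : ℂ, ∑ i, X i * ∑ j, Y j * (p * V i j + q * M i j + r * U i j)
      = p * bivApply V X Y + q * bivApply M X Y + r * bivApply U X Y := by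
    intro p q r
    simp only [bivApply, Finset.mul_sum, ← Finset.sum_add_distrib]
    refine Finset.sum_congr rfl fun k _ => Finset.sum_congr rfl fun l _ => by ring
  rw [h']
  ring

/-- The three anti-self-dual bivectors vanish on the rotated pair `(k, m)`, and the self-dual ones
take the values `1`, `2 conj c`, `conj c ^ 2`. So only the unconjugated scalars enter, in a quartic
in `conj c`. -/
lemma weylScalar_rotFirst_zero (hg : IsLorentzian g) (hW : IsWeylCandidate g W)
    (hT : IsNullTetrad g T) (c : ℂ) :
    weylScalar W (T.rotFirst c) 0 = weylScalar W T 0 + 4 * conj c * weylScalar W T 1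
      + 6 * conj c ^ 2 * weylScalar W T 2 + 4 * conj c ^ 3 * weylScalar W T 3
      + conj c ^ 4 * weylScalar W T 4 := by
  have h0 : weylScalar W (T.rotFirst c) 0 = evalC W (toC (T.rotFirst c).k) (T.rotFirst c).m
      (toC (T.rotFirst c).k) (T.rotFirst c).m := rfl
  rw [h0, toC_rotFirst_k, rotFirst_m]
  rw [evalC_vecMul_first]
  simp only [evalC_vecMul_second]
  simp only [evalC_vecMul_third]
  simp only [evalC_vecMul_fourth]
  have h : ∀ i j k l, evalC W (T.frame i) (T.frame j) (T.frame k) (T.frame l)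
      = weylForm bivV bivM bivU (weylScalar W T) i j k l
        + weylForm bivV' bivM' bivU' (weylScalarBar W T) i j k l := frameComp_eq hg hW hT
  simp only [h, mul_add, Finset.sum_add_distrib, sum_weylForm]
  simp [bivApply, Fin.sum_univ_four, bivV, bivM, bivU, bivV', bivM', bivU']
  ring

/-- Exchanging `k` and `l` while keeping `m` reverses the orientation, hence the complex conjugate.
-/
lemma weylScalar_swap_zero (hW : IsWeylCandidate g W) :
    weylScalar W T.swap 0 = conj (weylScalar W T 4) := by
  change evalC W (toC T.l) T.m (toC T.l) T.m
    = conj (evalC W (cconj T.m) (toC T.l) (cconj T.m) (toC T.l))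
  rw [conj_evalC, cconj_cconj, cconj_toC, hW.evalC_antisymm_left, hW.evalC_antisymm_right]
  ring

lemma weylScalar_swap_one (hW : IsWeylCandidate g W) :
    weylScalar W T.swap 1 = conj (weylScalar W T 3) := by
  change evalC W (toC T.l) (toC T.k) (toC T.l) T.m
    = conj (evalC W (toC T.k) (toC T.l) (cconj T.m) (toC T.l))
  rw [conj_evalC, cconj_cconj, cconj_toC, cconj_toC, hW.evalC_antisymm_left,
    hW.evalC_antisymm_right]
  ring

lemma IsPND.weylScalar_eq_zero {q : Fin 5} (h : IsPND g W q T.k) (hT : IsNullTetrad g T)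
    {i : Fin 5} (hi : i < q) : weylScalar W T i = 0 :=
  (h.2.2.2 T hT rfl).1 i hi

lemma IsPND.weylScalar_four_eq_zero {q : Fin 5} (h : IsPND g W q T.l) (hg : IsLorentzian g)
    (hW : IsWeylCandidate g W) (hT : IsNullTetrad g T) : weylScalar W T 4 = 0 := by
  have := IsPND.weylScalar_eq_zero (T := T.swap) h (hT.swap hg) h.2.2.1
  rw [weylScalar_swap_zero hW] at this
  simpa using this

lemma IsPND.weylScalar_three_eq_zero (h : IsPND g W 2 T.l) (hg : IsLorentzian g)
    (hW : IsWeylCandidate g W) (hT : IsNullTetrad g T) : weylScalar W T 3 = 0 := by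
  have := IsPND.weylScalar_eq_zero (T := T.swap) (i := 1) h (hT.swap hg) (by decide)
  rw [weylScalar_swap_one hW] at this
  simpa using this

lemma evalC_smul_first_third (r : ℝ) (x y : CVec) :
    evalC W (fun i => (r : ℂ) * x i) y (fun i => (r : ℂ) * x i) y = r ^ 2 * evalC W x y x y := by
  simp only [evalC, Finset.mul_sum]
  refine Finset.sum_congr rfl fun a _ => Finset.sum_congr rfl fun b _ =>
          Finset.sum_congr rfl fun c _ => Finset.sum_congr rfl fun d _ => by ring

lemma IsNullTetrad.smul (hT : IsNullTetrad g T) {r : ℝ} (hr : r ≠ 0) :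
    IsNullTetrad g ⟨r⁻¹ • T.k, r • T.l, T.m⟩ := by
  have hs : ∀ (s : ℝ) (x : Vec), toC (s • x) = (s : ℂ) • toC x := by
    intro s x; funext i; simp [toC]
  constructor
  · simp only [dot_smul_left, dot_smul_right, hT.kk, mul_zero]
  · simp only [dot_smul_left, dot_smul_right, hT.ll, mul_zero]
  · simp only [dot_smul_left, dot_smul_right, hT.kl]; field_simp
  · exact hT.mm
  · exact hT.mmbar
  · simp only [hs, cdot_smul_left, hT.km, mul_zero]
  · simp only [hs, cdot_smul_left, hT.lm, mul_zero]

/-- The definition of a principal direction speaks of tetrads whose first vector is exactly `x`. A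
boost of `k` and `l` by inverse factors reaches such a tetrad and only rescales `φ₀`. -/
lemma IsPND.weylScalar_zero_of_sameDirection {q : Fin 5} {x : Vec} (h : IsPND g W q x)
    (hT : IsNullTetrad g T) (hx : SameDirection T.k x) : weylScalar W T 0 = 0 := by
  obtain ⟨r, hr, hk⟩ := hx
  have hx' : r⁻¹ • T.k = x := by rw [hk, smul_smul, inv_mul_cancel₀ hr, one_smul]
  rw [← hx'] at h
  have h0 := IsPND.weylScalar_eq_zero (T := ⟨r⁻¹ • T.k, r • T.l, T.m⟩) h (hT.smul hr) h.2.2.1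
  have h1 : weylScalar W ⟨r⁻¹ • T.k, r • T.l, T.m⟩ 0
      = (r⁻¹ : ℝ) ^ 2 * weylScalar W T 0 := by
    have : toC (r⁻¹ • T.k) = fun i => ((r⁻¹ : ℝ) : ℂ) * toC T.k i := by
      funext i; simp [toC]
    change evalC W (toC (r⁻¹ • T.k)) T.m (toC (r⁻¹ • T.k)) T.m = _
    rw [this, evalC_smul_first_third]
    rfl
  rw [h1] at h0
  simpa [hr] using h0

lemma IsPND.weylScalar_polynomial {q : Fin 5} {x : Vec} (h : IsPND g W q x)
    (hg : IsLorentzian g) (hW : IsWeylCandidate g W) (hT : IsNullTetrad g T) {c : ℂ}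
    (hx : SameDirection (T.rotFirst c).k x) :
    weylScalar W T 0 + 4 * conj c * weylScalar W T 1
      + 6 * conj c ^ 2 * weylScalar W T 2 + 4 * conj c ^ 3 * weylScalar W T 3
      + conj c ^ 4 * weylScalar W T 4 = 0 := by
  rw [← weylScalar_rotFirst_zero hg hW hT]
  exact h.weylScalar_zero_of_sameDirection (hT.rotFirst hg c) hx

end Scalars

/-! ### The flux as a polynomial in scalar products -/

section Flux

variable {g : Matrix (Fin 4) (Fin 4) ℝ} {W : Tensor4} {T : Tetrad}

/-- Symmetric cubic expression in `u` built from three null vectors. -/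
noncomputable def tripleForm (g : Matrix (Fin 4) (Fin 4) ℝ) (u x y z : Vec) : ℝ :=
  -4 * (dot g u x * dot g u y * dot g u z)
    + 1 / 2 * dot g u u * (dot g u x * dot g y z + dot g u y * dot g x z + dot g u z * dot g x y)

/-- The flux `n·P(u)`, up to a factor, of the Weyl tensor with principal null vectors
`x, y, z, w`. -/
noncomputable def fluxForm (g : Matrix (Fin 4) (Fin 4) ℝ) (n u x y z w : Vec) : ℝ :=
  4 * (dot g n x * tripleForm g u y z w + dot g n y * tripleForm g u x z w
      + dot g n z * tripleForm g u x y w + dot g n w * tripleForm g u x y z)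
    + dot g n u * (4 * (dot g u x * dot g u y * dot g z w + dot g u x * dot g u z * dot g y w
        + dot g u x * dot g u w * dot g y z + dot g u y * dot g u z * dot g x w
        + dot g u y * dot g u w * dot g x z + dot g u z * dot g u w * dot g x y)
      - 4 / 3 * dot g u u * (dot g x y * dot g z w + dot g x z * dot g y w
        + dot g x w * dot g y z))

lemma belRobinsonForm_explicit (φ ψ : Fin 5 → ℂ) (N X : Fin 4 → ℂ) :
    belRobinsonForm φ ψ N X = 4 * spinContract N (spinContract X (spinContract X (spinContract X
      fun i j => ![φ 0, φ 1, φ 2, φ 3, φ 4] (Fin.ofNat 5 i)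
        * ![ψ 0, ψ 1, ψ 2, ψ 3, ψ 4] (Fin.ofNat 5 j)))) 0 0 := by
  have h : ∀ φ : Fin 5 → ℂ, ![φ 0, φ 1, φ 2, φ 3, φ 4] = φ := by
    intro φ; funext i; fin_cases i <;> rfl
  rw [h, h, belRobinsonForm]

/-- The hypotheses are Vieta's relations for the quartic with roots `0`, `∞`, `conj c₁`, `conj c₂`.
Nothing requires the roots to differ or to be nonzero, so types II and III are covered by setting
one or both to `0`. Neither `u` nor `n` is normalised here. -/
lemma dot_supermomentum_of_roots (hg : IsLorentzian g) (hW : IsWeylCandidate g W)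
    (hT : IsNullTetrad g T) (c₁ c₂ : ℂ) (h0 : weylScalar W T 0 = 0) (h4 : weylScalar W T 4 = 0)
    (h1 : weylScalar W T 1 = conj c₁ * conj c₂ * weylScalar W T 3)
    (h2 : weylScalar W T 2 = -(2 / 3) * (conj c₁ + conj c₂) * weylScalar W T 3) (u n : Vec) :
    dot g n (supermomentum g W u) = Complex.normSq (weylScalar W T 3)
      * fluxForm g n u T.k T.l (T.rotFirst c₁).k (T.rotFirst c₂).k := by
  have hk : T.coord g (toC T.k) = ![1, 0, 0, 0] := by rw [toC_k_eq, coord_vecMul hg hT]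
  have hl : T.coord g (toC T.l) = ![0, 1, 0, 0] := by rw [toC_l_eq, coord_vecMul hg hT]
  rw [← Complex.ofReal_inj, dot_supermomentum_eq hg hW hT, belRobinsonForm_explicit, fluxForm]
  simp only [tripleForm]
  push_cast
  simp only [dot_eq_coord hg hT, coord_rotFirst_k hg hT, hk, hl]
  rw [weylScalarBar, weylScalarBar, weylScalarBar, weylScalarBar, weylScalarBar, h0, h1, h2, h4,
    Complex.normSq_eq_conj_mul_self]
  generalize T.coord g (toC n) = N
  generalize T.coord g (toC u) = X
  generalize weylScalar W T 3 = f
  simp only [map_mul, map_add, map_neg, map_zero, Complex.conj_conj, map_div₀, map_ofNat]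
  generalize conj c₁ = z₁
  generalize conj c₂ = z₂
  generalize conj f = h
  have p0 : (Fin.ofNat 5 0) = 0 := rfl
  have p1 : (Fin.ofNat 5 1) = 1 := rfl
  have p2 : (Fin.ofNat 5 2) = 2 := rfl
  have p3 : (Fin.ofNat 5 3) = 3 := rfl
  have p4 : (Fin.ofNat 5 4) = 4 := rfl
  simp only [spinContract, zero_add, one_add_one_eq_two, Nat.reduceAdd, p0, p1, p2, p3, p4]
  simp
  ring

end Flux

/-! ### Degenerate flux forms, brackets, and the two tetrads of type I -/

section Special

variable {g : Matrix (Fin 4) (Fin 4) ℝ} {W : Tensor4} {T : Tetrad}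

/-- Both `0` and `∞` are double roots, so `φ₃ = 0` and normalisation by `φ₃` is impossible. The
factor `9/4` is the inverse square of the `2/3` in Vieta's relation, as found by sending one root to
infinity. -/
lemma dot_supermomentum_of_double (hg : IsLorentzian g) (hW : IsWeylCandidate g W)
    (hT : IsNullTetrad g T) (h0 : weylScalar W T 0 = 0) (h1 : weylScalar W T 1 = 0)
    (h3 : weylScalar W T 3 = 0) (h4 : weylScalar W T 4 = 0) (u n : Vec) :
    dot g n (supermomentum g W u) = 9 / 4 * Complex.normSq (weylScalar W T 2)
      * fluxForm g n u T.k T.l T.k T.l := by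
  have hk : T.coord g (toC T.k) = ![1, 0, 0, 0] := by rw [toC_k_eq, coord_vecMul hg hT]
  have hl : T.coord g (toC T.l) = ![0, 1, 0, 0] := by rw [toC_l_eq, coord_vecMul hg hT]
  rw [← Complex.ofReal_inj, dot_supermomentum_eq hg hW hT, belRobinsonForm_explicit, fluxForm]
  simp only [tripleForm]
  push_cast
  simp only [dot_eq_coord hg hT, hk, hl]
  rw [weylScalarBar, weylScalarBar, weylScalarBar, weylScalarBar, weylScalarBar, h0, h1, h3, h4,
    Complex.normSq_eq_conj_mul_self, map_zero]
  have p0 : (Fin.ofNat 5 0) = 0 := rfl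
  have p1 : (Fin.ofNat 5 1) = 1 := rfl
  have p2 : (Fin.ofNat 5 2) = 2 := rfl
  have p3 : (Fin.ofNat 5 3) = 3 := rfl
  have p4 : (Fin.ofNat 5 4) = 4 := rfl
  simp only [spinContract, zero_add, one_add_one_eq_two, Nat.reduceAdd, p0, p1, p2, p3, p4]
  simp
  ring

lemma dot_supermomentum_of_quadruple (hg : IsLorentzian g) (hW : IsWeylCandidate g W)
    (hT : IsNullTetrad g T) (h0 : weylScalar W T 0 = 0) (h1 : weylScalar W T 1 = 0)
    (h2 : weylScalar W T 2 = 0) (h3 : weylScalar W T 3 = 0) (u n : Vec) :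
    dot g n (supermomentum g W u) = 4 * Complex.normSq (weylScalar W T 4)
      * compB g u T ^ 3 * dot g n T.k := by
  have hk : T.coord g (toC T.k) = ![1, 0, 0, 0] := by rw [toC_k_eq, coord_vecMul hg hT]
  rw [← Complex.ofReal_inj, dot_supermomentum_eq hg hW hT, belRobinsonForm_explicit, compB]
  push_cast
  simp only [dot_eq_coord hg hT, hk]
  rw [weylScalarBar, weylScalarBar, weylScalarBar, weylScalarBar, weylScalarBar, h0, h1, h2, h3,
    Complex.normSq_eq_conj_mul_self, map_zero]
  have p0 : (Fin.ofNat 5 0) = 0 := rfl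
  have p1 : (Fin.ofNat 5 1) = 1 := rfl
  have p2 : (Fin.ofNat 5 2) = 2 := rfl
  have p3 : (Fin.ofNat 5 3) = 3 := rfl
  have p4 : (Fin.ofNat 5 4) = 4 := rfl
  simp only [spinContract, zero_add, one_add_one_eq_two, Nat.reduceAdd, p0, p1, p2, p3, p4]
  simp
  ring

lemma rotFirst_zero_k (T : Tetrad) : (T.rotFirst 0).k = T.k := by
  funext i; simp [Tetrad.rotFirst]

lemma dot_rotFirst_k (hg : IsLorentzian g) (hT : IsNullTetrad g T) (c₁ c₂ : ℂ) :
    dot g (T.rotFirst c₁).k (T.rotFirst c₂).k = -Complex.normSq (c₁ - c₂) := by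
  rw [← Complex.ofReal_inj, dot_eq_coord hg hT, coord_rotFirst_k hg hT, coord_rotFirst_k hg hT,
    Complex.ofReal_neg, Complex.normSq_eq_conj_mul_self]
  simp
  ring

lemma dot_rotFirst_k_l (hg : IsLorentzian g) (hT : IsNullTetrad g T) (c : ℂ) :
    dot g (T.rotFirst c).k T.l = -1 := (hT.rotFirst hg c).kl

lemma dot_rotFirst_k_k (hg : IsLorentzian g) (hT : IsNullTetrad g T) (c : ℂ) :
    dot g (T.rotFirst c).k T.k = -Complex.normSq c := by
  have := dot_rotFirst_k hg hT c 0
  rwa [rotFirst_zero_k, sub_zero] at this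

lemma IsFutureTetrad.rotFirst_eq_smul (hg : IsLorentzian g) {u x : Vec} (hu : dot g u u = -1)
    (hT : IsFutureTetrad g u T) (hx : IsFuture g u x) {c : ℂ}
    (hc : SameDirection (T.rotFirst c).k x) :
    0 < -dot g T.l x ∧ (T.rotFirst c).k = (-dot g T.l x)⁻¹ • x ∧
      Complex.normSq c = dot g T.k x / dot g T.l x := by
  obtain ⟨r, hr, h⟩ := hc
  have h1 := dot_rotFirst_k_l hg hT.null c
  have h2 := dot_rotFirst_k_k hg hT.null c
  have h3 := (hT.rotFirst hg hu c).future_k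
  rw [h, dot_smul_left, dot_comm hg] at h1 h2
  rw [IsFuture, h, dot_smul_left] at h3
  rw [IsFuture] at hx
  -- Both vectors are future oriented, which excludes a negative factor; its value then follows from
  -- the normalisation `k·l = -1`.
  have hr0 : 0 < r := by
    by_contra h0
    nlinarith [mul_nonneg_of_nonpos_of_nonpos (not_lt.mp h0) hx.le]
  have hl : 0 < -dot g T.l x := by
    by_contra h0
    nlinarith [mul_nonneg hr0.le (by linarith : 0 ≤ dot g T.l x)]
  have hr' : r = (-dot g T.l x)⁻¹ := eq_inv_of_mul_eq_one_left (by linarith)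
  refine ⟨hl, by rw [h, hr'], ?_⟩
  have hne : dot g T.l x ≠ 0 := by linarith
  rw [eq_div_iff hne]
  linear_combination dot g T.l x * h2 - dot g T.k x * h1

lemma RotateTo.spec (hg : IsLorentzian g) {u x : Vec} (hu : dot g u u = -1)
    (hT : IsFutureTetrad g u T) (hx : IsFuture g u x) {c e : ℂ} (h : RotateTo T x c e) :
    0 < -dot g T.k x ∧ 0 < -dot g T.l x ∧ (T.rotFirst c).k = (-dot g T.l x)⁻¹ • x ∧
      (T.rotSecond e).l = (-dot g T.k x)⁻¹ • x ∧
      Complex.normSq c = dot g T.k x / dot g T.l x ∧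
      Complex.normSq e = dot g T.l x / dot g T.k x := by
  obtain ⟨h1, h2, h3⟩ := hT.rotFirst_eq_smul hg hu hx h.1
  obtain ⟨h4, h5, h6⟩ := (hT.swap hg).rotFirst_eq_smul hg hu hx h.2
  exact ⟨h4, h1, h2, h5, h3, h6⟩

/-- Normalisation turns `ab/3 + |d|²` into `4ab/3 - 1/2`. Each summand then contributes one third of
the cubic product of `u` with `k`, `l`, `x`, and the three constants `-1/2` give the three trace
terms. -/
lemma bracket_eq (hg : IsLorentzian g) {u x : Vec} (hu : dot g u u = -1)
    (hT : IsFutureTetrad g u T) (hx : IsFuture g u x) {c e : ℂ} (h : RotateTo T x c e) :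
    bracket g u T c e = tripleForm g u T.k T.l x / -dot g T.l x := by
  obtain ⟨h1, h2, h3, h4, h5, h6⟩ := h.spec hg hu hT hx
  rw [bracket, third_eq hg (hT.null.rotFirst hg c) hu, third_eq hg (hT.null.rotSecond hg e) hu,
    third_eq hg hT.null hu, h5, tripleForm, hu, hT.null.kl]
  have e1 : compA g u (T.rotSecond e) = (-dot g T.k x)⁻¹ * -dot g u x := by
    rw [compA, h4, dot_smul_right]; ring
  have e2 : compB g u (T.rotFirst c) = (-dot g T.l x)⁻¹ * -dot g u x := by
    rw [compB, h3, dot_smul_right]; ring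
  have e3 : compB g u (T.rotSecond e) = -dot g u T.k := rfl
  have e4 : compA g u (T.rotFirst c) = -dot g u T.l := rfl
  rw [e1, e2, e3, e4, compA, compB]
  have n1 : dot g T.k x ≠ 0 := by linarith
  have n2 : dot g T.l x ≠ 0 := by linarith
  field_simp
  ring

lemma bracket_pos (hg : IsLorentzian g) {u : Vec} (hu : dot g u u = -1)
    (hT : IsFutureTetrad g u T) (c e : ℂ) : 0 < bracket g u T c e := by
  have h1 := mul_nonneg (mul_nonneg (hT.compA_pos hg).le (Complex.normSq_nonneg c))
    ((hT.rotSecond hg hu e).third_pos hg).le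
  have h2 := mul_pos (hT.compB_pos hg) ((hT.rotFirst hg hu c).third_pos hg)
  have h3 := mul_pos ((hT.rotFirst hg hu c).compB_pos hg) (hT.third_pos hg)
  rw [bracket]; linarith

lemma fluxForm_smul (n u x y z w : Vec) (r s : ℝ) :
    fluxForm g n u x y (r • z) (s • w) = r * s * fluxForm g n u x y z w := by
  simp only [fluxForm, tripleForm, dot_smul_left, dot_smul_right]
  ring

lemma fluxForm_swap (hg : IsLorentzian g) (n u x y z w : Vec) :
    fluxForm g n u z w x y = fluxForm g n u x y z w := by
  simp only [fluxForm, tripleForm, dot_comm hg z x, dot_comm hg z y, dot_comm hg w x,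
    dot_comm hg w y]
  ring

lemma tripleForm_rotate (hg : IsLorentzian g) (u x y z : Vec) :
    tripleForm g u x y z = tripleForm g u z x y := by
  simp only [tripleForm, dot_comm hg z x, dot_comm hg z y]
  ring

lemma fluxForm_null {x : Vec} (hx : dot g x x = 0) (k₁ k₂ k₃ k₄ : Vec) :
    fluxForm g x x k₁ k₂ k₃ k₄
      = -64 * (dot g x k₁ * dot g x k₂ * dot g x k₃ * dot g x k₄) := by
  simp only [fluxForm, tripleForm, hx]
  ring

lemma not_sameDirection_symm {x y : Vec} (h : ¬SameDirection x y) : ¬SameDirection y x := by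
  rintro ⟨r, hr, e⟩
  exact h ⟨r⁻¹, inv_ne_zero hr, by rw [e, smul_smul, inv_mul_cancel₀ hr, one_smul]⟩

lemma param_ne_zero {x : Vec} {c : ℂ} (h : SameDirection (T.rotFirst c).k x)
    (hx : ¬SameDirection T.k x) : c ≠ 0 := by
  rintro rfl
  rw [rotFirst_zero_k] at h
  exact hx h

lemma param_ne {x y : Vec} {c₁ c₂ : ℂ} (h₁ : SameDirection (T.rotFirst c₁).k x)
    (h₂ : SameDirection (T.rotFirst c₂).k y) (hxy : ¬SameDirection x y) : c₁ ≠ c₂ := by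
  rintro rfl
  obtain ⟨r, hr, e₁⟩ := h₁
  obtain ⟨s, hs, e₂⟩ := h₂
  refine hxy ⟨r⁻¹ * s, mul_ne_zero (inv_ne_zero hr) hs, ?_⟩
  rw [← smul_smul, ← e₂, e₁, smul_smul, inv_mul_cancel₀ hr, one_smul]

/-- The observer `u` only fixes time orientation; the flux is taken along an arbitrary `v`, which
the comparison of two tetrads needs. -/
lemma petrovI_flux (hg : IsLorentzian g) (hW : IsWeylCandidate g W) {u x y : Vec}
    (hu : dot g u u = -1) (hT : IsFutureTetrad g u T) (hx : IsFuture g u x) (hy : IsFuture g u y)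
    (h : IsPetrovI g W T.k T.l x y) {c₁ c₂ : ℂ} (h₁ : SameDirection (T.rotFirst c₁).k x)
    (h₂ : SameDirection (T.rotFirst c₂).k y) (v n : Vec) :
    dot g n (supermomentum g W v) = Complex.normSq (weylScalar W T 3)
      / (dot g T.l x * dot g T.l y) * fluxForm g n v T.k T.l x y := by
  obtain ⟨pk, pl, px, py, hpw⟩ := h
  simp only [List.pairwise_cons, List.mem_cons, List.not_mem_nil, or_false, forall_eq_or_imp,
    forall_eq] at hpw
  obtain ⟨⟨-, hkx, hky⟩, -, hxy, -⟩ := hpw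
  have e0 := pk.weylScalar_eq_zero hT.null (i := 0) (by decide)
  have e4 := pl.weylScalar_four_eq_zero hg hW hT.null
  have q1 := px.weylScalar_polynomial hg hW hT.null h₁
  have q2 := py.weylScalar_polynomial hg hW hT.null h₂
  have z1 : conj c₁ ≠ 0 := (map_ne_zero _).mpr (param_ne_zero h₁ hkx)
  have z2 : conj c₂ ≠ 0 := (map_ne_zero _).mpr (param_ne_zero h₂ hky)
  have z12 : conj c₁ - conj c₂ ≠ 0 := by
    rw [← map_sub]; exact (map_ne_zero _).mpr (sub_ne_zero.mpr (param_ne h₁ h₂ hxy))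
  rw [e0, e4] at q1 q2
  have r1 : 2 * weylScalar W T 1 + 3 * conj c₁ * weylScalar W T 2
      + 2 * conj c₁ ^ 2 * weylScalar W T 3 = 0 := by
    apply mul_left_cancel₀ z1; linear_combination q1 / 2
  have r2 : 2 * weylScalar W T 1 + 3 * conj c₂ * weylScalar W T 2
      + 2 * conj c₂ ^ 2 * weylScalar W T 3 = 0 := by
    apply mul_left_cancel₀ z2; linear_combination q2 / 2
  -- Both nonzero roots satisfy the same quadratic. Subtracting and dividing by their difference is
  -- Vieta's relation for the sum.
  have r3 : weylScalar W T 2 = -(2 / 3) * (conj c₁ + conj c₂) * weylScalar W T 3 := by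
    apply mul_left_cancel₀ z12; linear_combination (r1 - r2) / 3
  have r4 : weylScalar W T 1 = conj c₁ * conj c₂ * weylScalar W T 3 := by
    linear_combination r1 / 2 - 3 / 2 * conj c₁ * r3
  rw [dot_supermomentum_of_roots hg hW hT.null c₁ c₂ e0 e4 r4 r3,
    (hT.rotFirst_eq_smul hg hu hx h₁).2.1, (hT.rotFirst_eq_smul hg hu hy h₂).2.1, fluxForm_smul,
    ← mul_inv, neg_mul_neg]
  ring

/-- Each tetrad writes the same flux as a constant times the same symmetric form in the four
principal vectors. The constants agree once that form is nonzero somewhere, and on a null vector it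
is a multiple of the product of the four scalar products. -/
lemma petrovI_scalar_eq (hg : IsLorentzian g) (hW : IsWeylCandidate g W) {S : Tetrad} {u : Vec}
    (hu : dot g u u = -1) (hT : IsFutureTetrad g u T) (hS : IsFutureTetrad g u S)
    (h : IsPetrovI g W T.k T.l S.k S.l) {c₁ c₂ f₁ f₂ : ℂ}
    (h₁ : SameDirection (T.rotFirst c₁).k S.k) (h₂ : SameDirection (T.rotFirst c₂).k S.l)
    (k₁ : SameDirection (S.rotFirst f₁).k T.k) (k₂ : SameDirection (S.rotFirst f₂).k T.l) :
    Complex.normSq (weylScalar W S 3) / (dot g S.l T.k * dot g S.l T.l)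
      = Complex.normSq (weylScalar W T 3) / (dot g T.l S.k * dot g T.l S.l) := by
  have h' : IsPetrovI g W S.k S.l T.k T.l := by
    obtain ⟨pk, pl, px, py, hpw⟩ := h
    refine ⟨px, py, pk, pl, ?_⟩
    simp only [List.pairwise_cons, List.mem_cons, List.not_mem_nil, or_false, forall_eq_or_imp,
      forall_eq, List.Pairwise.nil, and_true, false_implies, implies_true] at hpw ⊢
    obtain ⟨⟨a1, a2, a3⟩, ⟨a4, a5⟩, a6⟩ := hpw
    exact ⟨⟨a6, not_sameDirection_symm a2, not_sameDirection_symm a4⟩,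
      ⟨not_sameDirection_symm a3, not_sameDirection_symm a5⟩, a1⟩
  -- Avoiding these parameters keeps the rotated null vector off `T.k`, `S.k` and `S.l`; it is never
  -- parallel to `T.l`.
  obtain ⟨c, hc⟩ := Infinite.exists_notMem_finset ({0, c₁, c₂} : Finset ℂ)
  simp only [Finset.mem_insert, Finset.mem_singleton, not_or] at hc
  have e1 := petrovI_flux hg hW hu hT hS.future_k hS.future_l h h₁ h₂ (T.rotFirst c).k
    (T.rotFirst c).k
  have e2 := petrovI_flux hg hW hu hS hT.future_k hT.future_l h' k₁ k₂ (T.rotFirst c).k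
    (T.rotFirst c).k
  rw [fluxForm_swap hg, e1] at e2
  have n0 : fluxForm g (T.rotFirst c).k (T.rotFirst c).k T.k T.l S.k S.l ≠ 0 := by
    rw [fluxForm_null (hT.null.rotFirst hg c).kk, dot_rotFirst_k_k hg hT.null,
      dot_rotFirst_k_l hg hT.null]
    have m1 : dot g (T.rotFirst c).k S.k ≠ 0 := by
      intro h0
      have := dot_rotFirst_k hg hT.null c c₁
      rw [(hT.rotFirst_eq_smul hg hu hS.future_k h₁).2.1, dot_smul_right, h0, mul_zero] at this
      exact hc.2.1 (sub_eq_zero.mp (Complex.normSq_eq_zero.mp (neg_eq_zero.mp this.symm)))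
    have m2 : dot g (T.rotFirst c).k S.l ≠ 0 := by
      intro h0
      have := dot_rotFirst_k hg hT.null c c₂
      rw [(hT.rotFirst_eq_smul hg hu hS.future_l h₂).2.1, dot_smul_right, h0, mul_zero] at this
      exact hc.2.2 (sub_eq_zero.mp (Complex.normSq_eq_zero.mp (neg_eq_zero.mp this.symm)))
    have m3 : Complex.normSq c ≠ 0 := fun h0 => hc.1 (Complex.normSq_eq_zero.mp h0)
    simp [m1, m2, m3]
  exact (mul_right_cancel₀ n0 e2).symm

end Special

/-! ### The flux for each Petrov type -/

section Types

variable {g : Matrix (Fin 4) (Fin 4) ℝ} {W : Tensor4} {T : Tetrad} {u n : Vec}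

lemma flux_petrovI (hg : IsLorentzian g) (hW : IsWeylCandidate g W) {S : Tetrad}
    (hu : dot g u u = -1) (hun : dot g u n = 0) (hT : IsFutureTetrad g u T)
    (hS : IsFutureTetrad g u S) (h : IsPetrovI g W T.k T.l S.k S.l) {ct cp cb ch ft fp fb fh : ℂ}
    (hct : RotateTo T S.k ct cp) (hcb : RotateTo T S.l cb ch) (hft : RotateTo S T.k ft fp)
    (hfb : RotateTo S T.l fb fh) :
    dot g n (supermomentum g W u) =
      4 * Complex.normSq (weylScalar W S 3) / (-dot g T.k S.l) *
        (dot g n T.k * bracket g u S fb fh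
          + dot g n T.l * Complex.normSq cb * bracket g u S ft fp)
      + 4 * Complex.normSq (weylScalar W T 3) *
        (dot g n (T.rotFirst ct).k * bracket g u T cb ch
          + dot g n (T.rotFirst cb).k * bracket g u T ct cp) := by
  have hs := petrovI_scalar_eq hg hW hu hT hS h hct.1 hcb.1 hft.1 hfb.1
  rw [petrovI_flux hg hW hu hT hS.future_k hS.future_l h hct.1 hcb.1 u n,
    bracket_eq hg hu hS hT.future_l hfb, bracket_eq hg hu hS hT.future_k hft,
    bracket_eq hg hu hT hS.future_k hct, bracket_eq hg hu hT hS.future_l hcb]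
  obtain ⟨a1, a2, a3, -, -, -⟩ := hct.spec hg hu hT hS.future_k
  obtain ⟨b1, b2, b3, -, b4, -⟩ := hcb.spec hg hu hT hS.future_l
  rw [a3, b3, b4, dot_smul_right, dot_smul_right, fluxForm, dot_comm hg n u, hun,
    tripleForm_rotate hg u S.k S.l T.k, tripleForm_rotate hg u S.k S.l T.l,
    dot_comm hg S.l T.k, dot_comm hg S.l T.l]
  rw [dot_comm hg S.l T.k, dot_comm hg S.l T.l] at hs
  have n1 : dot g T.k S.l ≠ 0 := by linarith
  have n2 : dot g T.l S.l ≠ 0 := by linarith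
  have n3 : dot g T.l S.k ≠ 0 := by linarith
  -- The terms in `n·k₁` and `n·k₂` use brackets of `S`, so their `φ₃` is converted to that of `T`
  -- before comparing.
  have hs' : Complex.normSq (weylScalar W S 3) = Complex.normSq (weylScalar W T 3)
      / (dot g T.l S.k * dot g T.l S.l) * (dot g T.k S.l * dot g T.l S.l) := by
    rw [← hs]; field_simp
  rw [hs']
  field_simp
  ring

lemma flux_petrovII (hg : IsLorentzian g) (hW : IsWeylCandidate g W)
    (hu : dot g u u = -1) (hun : dot g u n = 0) (hT : IsFutureTetrad g u T) {k₄ : Vec}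
    (hk : IsFuture g u k₄) (h : IsPetrovII g W T.k T.l k₄) {cb ch : ℂ}
    (hc : RotateTo T k₄ cb ch) :
    dot g n (supermomentum g W u) =
      18 * Complex.normSq (weylScalar W T 2) *
        (dot g n T.k *
            (compA g u T * third g u (T.rotSecond ch)
              + compB g u T * Complex.normSq ch * third g u (T.rotFirst cb)
              + compA g u (T.rotSecond ch) * third g u T)
          + dot g n T.l * compB g u T * whole g u (T.rotSecond ch)
          + dot g n (T.rotFirst cb).k * Complex.normSq ch *
              (compB g u T * whole g u T)) := by
  obtain ⟨pk, pl, p4, hpw⟩ := h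
  simp only [List.pairwise_cons, List.mem_cons, List.not_mem_nil, or_false, forall_eq_or_imp,
    forall_eq] at hpw
  obtain ⟨⟨-, hk4⟩, -⟩ := hpw
  have e0 := pk.weylScalar_eq_zero hT.null (i := 0) (by decide)
  have e1 := pk.weylScalar_eq_zero hT.null (i := 1) (by decide)
  have e4 := pl.weylScalar_four_eq_zero hg hW hT.null
  have q := p4.weylScalar_polynomial hg hW hT.null hc.1
  have z : conj cb ≠ 0 := (map_ne_zero _).mpr (param_ne_zero hc.1 hk4)
  rw [e0, e1, e4] at q
  have r : weylScalar W T 2 = -(2 / 3) * conj cb * weylScalar W T 3 := by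
    apply mul_left_cancel₀ (pow_ne_zero 2 z); linear_combination q / 6
  obtain ⟨a1, a2, a3, a4, a5, a6⟩ := hc.spec hg hu hT hk
  have n1 : dot g T.k k₄ ≠ 0 := by linarith
  have n2 : dot g T.l k₄ ≠ 0 := by linarith
  -- The remaining root gives `φ₂ = -(2/3) conj c φ₃`, and `|c|²` is a ratio of scalar products.
  -- This exchanges the prefactor `|φ₃|²` for `|φ₂|²`.
  have hs : Complex.normSq (weylScalar W T 2)
      = 4 / 9 * (dot g T.k k₄ / dot g T.l k₄) * Complex.normSq (weylScalar W T 3) := by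
    rw [r, map_mul, map_mul, Complex.normSq_conj, a5]
    congr 2
    rw [Complex.normSq_apply]; norm_num
  -- The double direction `k` is the root `0` counted twice: once as `T.k`, once as the rotation
  -- with parameter `0`.
  rw [dot_supermomentum_of_roots hg hW hT.null 0 cb e0 e4 (by rw [e1]; simp)
    (by rw [r]; simp), rotFirst_zero_k, third_eq hg hT.null hu,
    third_eq hg (hT.null.rotFirst hg _) hu, third_eq hg (hT.null.rotSecond hg _) hu,
    whole_eq hg hT.null hu, whole_eq hg (hT.null.rotSecond hg _) hu, hs, a6, a3, fluxForm,
    dot_comm hg n u, hun]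
  have e1 : compA g u (T.rotSecond ch) = (-dot g T.k k₄)⁻¹ * -dot g u k₄ := by
    rw [compA, a4, dot_smul_right]; ring
  have e2 : compB g u (T.rotFirst cb) = (-dot g T.l k₄)⁻¹ * -dot g u k₄ := by
    rw [compB, a3, dot_smul_right]; ring
  have e3 : compB g u (T.rotSecond ch) = -dot g u T.k := rfl
  have e4 : compA g u (T.rotFirst cb) = -dot g u T.l := rfl
  rw [e1, e2, e3, e4, compA, compB]
  simp only [tripleForm, dot_smul_right, hu, hT.null.kk, hT.null.kl, dot_comm hg T.l T.k]
  field_simp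
  ring

lemma flux_petrovD (hg : IsLorentzian g) (hW : IsWeylCandidate g W)
    (hu : dot g u u = -1) (hun : dot g u n = 0) (hT : IsFutureTetrad g u T)
    (h : IsPetrovD g W T.k T.l) :
    dot g n (supermomentum g W u) =
      36 * Complex.normSq (weylScalar W T 2) *
        (compA g u T * dot g n T.k + compB g u T * dot g n T.l) * whole g u T := by
  obtain ⟨pk, pl, -⟩ := h
  rw [dot_supermomentum_of_double hg hW hT.null (pk.weylScalar_eq_zero hT.null (by decide))
    (pk.weylScalar_eq_zero hT.null (by decide)) (pl.weylScalar_three_eq_zero hg hW hT.null)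
    (pl.weylScalar_four_eq_zero hg hW hT.null), whole_eq hg hT.null hu, compA, compB, fluxForm,
    dot_comm hg n u, hun]
  simp only [tripleForm, hu, hT.null.kk, hT.null.ll, hT.null.kl, dot_comm hg T.l T.k]
  ring

lemma flux_petrovIII (hg : IsLorentzian g) (hW : IsWeylCandidate g W)
    (hu : dot g u u = -1) (hun : dot g u n = 0) (hT : IsFutureTetrad g u T)
    (h : IsPetrovIII g W T.k T.l) :
    dot g n (supermomentum g W u) =
      8 * Complex.normSq (weylScalar W T 3) *
        (dot g n T.k * (3 * compB g u T * whole g u T)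
          + 2 * compB g u T ^ 3 * dot g n T.l) := by
  obtain ⟨pk, pl, -⟩ := h
  have e1 := pk.weylScalar_eq_zero hT.null (i := 1) (by decide)
  have e2 := pk.weylScalar_eq_zero hT.null (i := 2) (by decide)
  -- With both parameters `0`, the vector `k` occurs three times and `l` once.
  rw [dot_supermomentum_of_roots hg hW hT.null 0 0 (pk.weylScalar_eq_zero hT.null (by decide))
    (pl.weylScalar_four_eq_zero hg hW hT.null) (by rw [e1]; simp) (by rw [e2]; simp),
    rotFirst_zero_k, whole_eq hg hT.null hu, compA, compB, fluxForm, dot_comm hg n u, hun]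
  simp only [tripleForm, hu, hT.null.kk, hT.null.kl, dot_comm hg T.l T.k]
  ring

lemma flux_petrovN (hg : IsLorentzian g) (hW : IsWeylCandidate g W)
    (hT : IsFutureTetrad g u T) (h : IsPetrovN g W T.k) :
    dot g n (supermomentum g W u) =
      4 * Complex.normSq (weylScalar W T 4) * compB g u T ^ 3 * dot g n T.k :=
  dot_supermomentum_of_quadruple hg hW hT.null (h.weylScalar_eq_zero hT.null (by decide))
    (h.weylScalar_eq_zero hT.null (by decide)) (h.weylScalar_eq_zero hT.null (by decide))
    (h.weylScalar_eq_zero hT.null (by decide)) u n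

end Types

end Superenergy

/-- Flux of superenergy `n·P(u)` in terms of the principal null directions. Decorations: with
`T = (k₁, k₂, m)`, the parameters `ct, cp` (tilde, prime) rotate `k₁`, resp. `k₂`, to `k₃`, and
`cb, ch` (breve, hat) rotate them to `k₄`; with `S = (k₃, k₄, m')`, the parameters `ft, fp` rotate
`k₃`, resp. `k₄`, to `k₁`, and `fb, fh` rotate them to `k₂`. -/
theorem mainTheorem3 (g : Matrix (Fin 4) (Fin 4) ℝ) (hg : IsLorentzian g)
    (W : Tensor4) (hW : IsWeylCandidate g W)
    (u n : Vec) (hu : dot g u u = -1) (hn : dot g n n = 1) (hun : dot g u n = 0) :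
    -- components of `u` in null tetrads, and null rotations to a given null direction
    (∀ T : Tetrad, IsFutureTetrad g u T →
      (∀ i, (u i : ℂ) = compA g u T * T.k i + compB g u T * T.l i
          + compD g u T * T.m i + star (compD g u T) * star (T.m i)) ∧
      compA g u T * compB g u T - Complex.normSq (compD g u T) = 1 / 2 ∧
      0 < compA g u T ∧ 0 < compB g u T ∧
      (∀ c : ℂ, IsFutureTetrad g u (T.rotFirst c) ∧ IsFutureTetrad g u (T.rotSecond c)) ∧
      ∀ x : Vec, dot g x x = 0 → IsFuture g u x →
        (¬SameDirection x T.l → ∃! c : ℂ, SameDirection (T.rotFirst c).k x) ∧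
        (¬SameDirection x T.k → ∃! c : ℂ, SameDirection (T.rotSecond c).l x)) ∧
    -- type I
    (∀ T S : Tetrad, IsFutureTetrad g u T → IsFutureTetrad g u S →
      IsPetrovI g W T.k T.l S.k S.l →
      ∀ ct cp cb ch ft fp fb fh : ℂ,
        RotateTo T S.k ct cp → RotateTo T S.l cb ch →
        RotateTo S T.k ft fp → RotateTo S T.l fb fh →
        0 < -dot g T.k S.l ∧
        0 < bracket g u S fb fh ∧ 0 < bracket g u S ft fp ∧
        0 < bracket g u T cb ch ∧ 0 < bracket g u T ct cp ∧
        dot g n (supermomentum g W u) =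
          4 * Complex.normSq (weylScalar W S 3) / (-dot g T.k S.l) *
            (dot g n T.k * bracket g u S fb fh
              + dot g n T.l * Complex.normSq cb * bracket g u S ft fp)
          + 4 * Complex.normSq (weylScalar W T 3) *
            (dot g n (T.rotFirst ct).k * bracket g u T cb ch
              + dot g n (T.rotFirst cb).k * bracket g u T ct cp)) ∧
    -- type II
    (∀ T : Tetrad, IsFutureTetrad g u T → ∀ k₄ : Vec, IsFuture g u k₄ →
      IsPetrovII g W T.k T.l k₄ → ∀ cb ch : ℂ, RotateTo T k₄ cb ch →
        dot g n (supermomentum g W u) =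
          18 * Complex.normSq (weylScalar W T 2) *
            (dot g n T.k *
                (compA g u T * third g u (T.rotSecond ch)
                  + compB g u T * Complex.normSq ch * third g u (T.rotFirst cb)
                  + compA g u (T.rotSecond ch) * third g u T)
              + dot g n T.l * compB g u T * whole g u (T.rotSecond ch)
              + dot g n (T.rotFirst cb).k * Complex.normSq ch *
                  (compB g u T * whole g u T))) ∧
    -- type D
    (∀ T : Tetrad, IsFutureTetrad g u T → IsPetrovD g W T.k T.l →
        dot g n (supermomentum g W u) =
          36 * Complex.normSq (weylScalar W T 2) *
            (compA g u T * dot g n T.k + compB g u T * dot g n T.l) * whole g u T) ∧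
    -- type III
    (∀ T : Tetrad, IsFutureTetrad g u T → IsPetrovIII g W T.k T.l →
        dot g n (supermomentum g W u) =
          8 * Complex.normSq (weylScalar W T 3) *
            (dot g n T.k * (3 * compB g u T * whole g u T)
              + 2 * compB g u T ^ 3 * dot g n T.l)) ∧
    -- type N
    (∀ T : Tetrad, IsFutureTetrad g u T → IsPetrovN g W T.k →
        dot g n (supermomentum g W u) =
          4 * Complex.normSq (weylScalar W T 4) * compB g u T ^ 3 * dot g n T.k) := by
  refine ⟨fun T hT => ⟨hT.null.eq_comp hg u, comp_unit hg hT.null hu, hT.compA_pos hg,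
      hT.compB_pos hg, fun c => ⟨hT.rotFirst hg hu c, hT.rotSecond hg hu c⟩,
      fun x hx hxu => ⟨existsUnique_rotFirst hg hT.null hx hxu,
        existsUnique_rotSecond hg hT.null hx hxu⟩⟩, ?_,
    fun T hT k₄ hk h cb ch hc => flux_petrovII hg hW hu hun hT hk h hc,
    fun T hT h => flux_petrovD hg hW hu hun hT h,
    fun T hT h => flux_petrovIII hg hW hu hun hT h,
    fun T hT h => flux_petrovN hg hW hT h⟩
  intro T S hT hS h ct cp cb ch ft fp fb fh hct hcb hft hfb
  exact ⟨(hcb.spec hg hu hT hS.future_l).1, bracket_pos hg hu hS _ _, bracket_pos hg hu hS _ _,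
    bracket_pos hg hu hT _ _, bracket_pos hg hu hT _ _,
    flux_petrovI hg hW hu hun hT hS h hct hcb hft hfb⟩
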